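/- Let $A_1=K^{ij}\partial_x$ with $K=(K^{ij})$ a constant symmetric invertible $n\times n$ matrix (a non-degenerate first-order Dubrovin–Novikov Hamiltonian operator written in its flat coordinates $u^1,\dots,u^n$), put $M=K^{-1}$, and let $A_2$ be a Hamiltonian matrix differential operator in the total derivative $\partial_x$ that is compatible with $A_1$, i.e. $[A_1,A_2]=0$. The coefficients of $A_2$ are smooth functions of finitely many of the derivative coordinates $u^i_\sigma$ ($\sigma$ the number of $x$-derivatives), defined on an open set $\Omega$ of the jet space. Introduce potentials by $u^i=\varphi^i_x$, and let $\mathbf H_k=\int h_k\,dx$, $k\ge 0$, be a bi-Hamiltonian hierarchy $$\varphi^i_{x t^k}=-A_2^{is}\,\partial_x^{-1}\frac{\delta \mathbf H_k}{\delta\varphi^s}=-K^{is}\frac{\delta \mathbf H_{k+1}}{\delta\varphi^s},$$ which is $u^i_{t^k}=A_2^{is}\,\delta\mathbf H_k/\delta u^s=A_1^{is}\,\delta\mathbf H_{k+1}/\delta u^s$ in potential variables. The hierarchy implies the systems $$B_{im}\varphi^m_{t^k}=\frac{\delta\mathbf H_{k+2}}{\delta\varphi^i},\qquad B_{ij}=-M_{ip}A_2^{pq}M_{qj}.$$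 A smooth vector function $(L_n)$ of finitely many of $u=\varphi_x,\ u_x=\varphi_{xx},\dots$ on $\Omega$ is called a Lagrangian representation of the hierarchy if, for every $k$, $L_n\varphi^n_{t^k}-h_{k+2}$ is a Lagrangian of this system, i.e. identically in the $(x,t^k)$-jet of $\varphi$ $$\frac{\delta}{\delta\varphi^i}\bigl(L_n\varphi^n_{t^k}-h_{k+2}\bigr)=B_{im}\varphi^m_{t^k}-\frac{\delta\mathbf H_{k+2}}{\delta\varphi^i}.$$ For a generalized vector field $\tau=\tau^i(u,u_x,\dots)\,\partial/\partial u^i$ on $\Omega$, the Lie derivative of $A_1$ is the operator on covectors $L_\tau A_1(\xi)=\ell_{A_1,\xi}(\tau)-\ell_\tau(A_1(\xi))-A_1(\ell_\tau^*(\xi))$, where $\ell$ denotes linearization (Fréchet derivative) and $^*$ the formal adjoint. Then finding a Lagrangian representation is equivalent to finding a generalized vector field $\tau$ with $A_2=L_\tau A_1$. Precisely: a smooth vector function $(L_n)$ on $\Omega$ is a Lagrangian representation of the hierarchy if and only if $A_2=L_\tau A_1$ for $$\tau^i=K^{in}\psi_n=-K^{in}L_n,\qquad \psi=-(L_n);$$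 the map $(L_n)\mapsto\tau$ is a bijection from the set of Lagrangian representations onto the set of generalized vector fields $\tau$ on $\Omega$ with $A_2=L_\tau A_1$; in particular, one set is nonempty if and only if the other is. -/

import Mathlib

open scoped ContDiff

noncomputable section

namespace VarCalc

/-! ### Jets and differential functions -/

/-- Points of the infinite jet space of `n` dependent variables. The type `S` is the monoid of
multi-indices: `S = ℕ` for the single independent variable `x`, and `S = ℕ × ℕ` for `(x, t)`.
The value `z (σ, i)` is the derivative coordinate with multi-index `σ` of the `i`-th variable.
The topology is the product topology. -/
abbrev Jet (S : Type) (n : ℕ) : Type := S × Fin n → ℝ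

/-- `f` is, on `Ω`, a `C^∞` function of finitely many derivative coordinates. -/
def IsDiffFun {S : Type} {n : ℕ} (Ω : Set (Jet S n)) (f : Jet S n → ℝ) : Prop :=
  ∃ (P : Finset (S × Fin n)) (g : (P → ℝ) → ℝ),
    ContDiffOn ℝ ∞ g ((fun (z : Jet S n) (p : P) => z p) '' Ω) ∧
      ∀ z ∈ Ω, f z = g (fun p => z p)

/-- Partial derivative with respect to the derivative coordinate `p`. -/
def pd {S : Type} [DecidableEq S] {n : ℕ} (p : S × Fin n) (f : Jet S n → ℝ) : Jet S n → ℝ :=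
  fun z => deriv (fun s : ℝ => f (Function.update z p s)) (z p)

/-- Total derivative in the direction `e`, i.e. `∑ u^j_{σ+e} ∂/∂u^j_σ`. -/
def totalD {S : Type} [DecidableEq S] [Add S] {n : ℕ} (e : S) (f : Jet S n → ℝ) :
    Jet S n → ℝ :=
  fun z => ∑ᶠ p : S × Fin n, pd p f z * z (p.1 + e, p.2)

/-- The total `x`-derivative for one independent variable. -/
def Dx {n : ℕ} (f : Jet ℕ n → ℝ) : Jet ℕ n → ℝ := totalD 1 f

/-- Variational derivative for the single independent variable `x`. -/
def euler {n : ℕ} (f : Jet ℕ n → ℝ) (i : Fin n) : Jet ℕ n → ℝ :=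
  fun z => ∑ᶠ σ : ℕ, (-1 : ℝ) ^ σ * (Dx^[σ] (pd (σ, i) f)) z

/-- Variational derivative for the two independent variables `(x, t)`. -/
def eulerXT {n : ℕ} (f : Jet (ℕ × ℕ) n → ℝ) (i : Fin n) : Jet (ℕ × ℕ) n → ℝ :=
  fun w => ∑ᶠ s : ℕ × ℕ, (-1 : ℝ) ^ (s.1 + s.2) *
    ((totalD ((1, 0) : ℕ × ℕ))^[s.1] ((totalD ((0, 1) : ℕ × ℕ))^[s.2] (pd (s, i) f))) w

/-! ### Matrix differential operators in total derivatives -/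

/-- Coefficients of a matrix differential operator: `P σ i j` is the coefficient of `∂_x^σ` in
the `(i, j)` entry. -/
abbrev DiffOp (n : ℕ) : Type := ℕ → Fin n → Fin n → Jet ℕ n → ℝ

/-- Vectors (or covectors) whose components are functions on the jet space. -/
abbrev VecFun (n : ℕ) : Type := Fin n → Jet ℕ n → ℝ

/-- A vector of differential functions. -/
def IsDiffVec {n : ℕ} (Ω : Set (Jet ℕ n)) (X : VecFun n) : Prop := ∀ i, IsDiffFun Ω (X i)

/-- `P` is, on `Ω`, a differential operator of finite order whose coefficients are
differential functions. -/
def IsDiffOp {n : ℕ} (Ω : Set (Jet ℕ n)) (P : DiffOp n) : Prop :=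
  (∀ σ i j, IsDiffFun Ω (P σ i j)) ∧ ∃ r : ℕ, ∀ σ, r < σ → ∀ i j, ∀ z ∈ Ω, P σ i j z = 0

/-- Action of a differential operator: `P(X)^i = P^{iσ}_j ∂_σ X^j`. -/
def DiffOp.app {n : ℕ} (P : DiffOp n) (X : VecFun n) : VecFun n :=
  fun i z => ∑ j, ∑ᶠ σ : ℕ, P σ i j z * (Dx^[σ] (X j)) z

/-- Action of the formal adjoint: `P^*(ξ)_j = (-1)^σ ∂_σ (P^{iσ}_j ξ_i)`. -/
def DiffOp.adjApp {n : ℕ} (P : DiffOp n) (ξ : VecFun n) : VecFun n :=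
  fun j z => ∑ i, ∑ᶠ σ : ℕ, (-1 : ℝ) ^ σ * (Dx^[σ] (fun y => P σ i j y * ξ i y)) z

/-- The linearization (Fréchet derivative) `ℓ_F` of a vector function. -/
def lin {n : ℕ} (F : VecFun n) : DiffOp n := fun σ k i => pd (σ, i) (F k)

/-- The linearization `ℓ_{A,ξ}` of the coefficients of `A`, the argument `ξ` being fixed:
`ℓ_{A,ξ}(Y)^i = (∂A^{iσ}_j/∂u^k_μ) ∂_σ ξ^j ∂_μ Y^k`. -/
def linOp {n : ℕ} (A : DiffOp n) (ξ : VecFun n) : DiffOp n :=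
  fun μ i k z => ∑ j, ∑ᶠ σ : ℕ, pd (μ, k) (A σ i j) z * (Dx^[σ] (ξ j)) z

/-- The Lie derivative `L_τ A` of an operator along the generalized vector field `τ`, acting on
the covector `ξ`: `ℓ_{A,ξ}(τ) - ℓ_τ(A(ξ)) - A(ℓ_τ^*(ξ))`. -/
def lieDeriv {n : ℕ} (τ : VecFun n) (A : DiffOp n) (ξ : VecFun n) : VecFun n :=
  fun i z => (linOp A ξ).app τ i z - (lin τ).app (A.app ξ) i z - A.app ((lin τ).adjApp ξ) i z

/-- `A = L_τ C` as operators on covectors over `Ω`. -/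
def IsLieDerivOf {n : ℕ} (Ω : Set (Jet ℕ n)) (A : DiffOp n) (τ : VecFun n) (C : DiffOp n) :
    Prop :=
  ∀ ξ : VecFun n, IsDiffVec Ω ξ → ∀ i, ∀ z ∈ Ω, A.app ξ i z = lieDeriv τ C ξ i z

/-- The Schouten bracket `[A, C]` of two skew-adjoint operators, as a bidifferential operator on
covectors. -/
def schouten {n : ℕ} (A C : DiffOp n) (ξ η : VecFun n) : VecFun n :=
  fun i z =>
    (linOp A ξ).app (C.app η) i z - (linOp A η).app (C.app ξ) i z
    + (linOp C ξ).app (A.app η) i z - (linOp C η).app (A.app ξ) i z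
    - A.app ((linOp C η).adjApp ξ) i z - C.app ((linOp A η).adjApp ξ) i z

/-- `[A, C] = 0` over `Ω`. -/
def Compatible {n : ℕ} (Ω : Set (Jet ℕ n)) (A C : DiffOp n) : Prop :=
  ∀ ξ η : VecFun n, IsDiffVec Ω ξ → IsDiffVec Ω η → ∀ i, ∀ z ∈ Ω, schouten A C ξ η i z = 0

/-- Hamiltonian operators over `Ω`: formally skew-adjoint, with `[A, A] = 0`. -/
def IsHamiltonian {n : ℕ} (Ω : Set (Jet ℕ n)) (A : DiffOp n) : Prop :=
  IsDiffOp Ω A ∧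
  (∀ ξ : VecFun n, IsDiffVec Ω ξ → ∀ i, ∀ z ∈ Ω, A.adjApp ξ i z = -A.app ξ i z) ∧
  Compatible Ω A A

/-- The operator `A₁ = K^{ij} ∂_x` with constant matrix `K`. -/
def constOp {n : ℕ} (K : Matrix (Fin n) (Fin n) ℝ) : DiffOp n :=
  fun σ i j _ => if σ = 1 then K i j else 0

/-! ### Potential variables `u^i = φ^i_x` -/

/-- The `u`-jet of a `φ`-jet under `u^i = φ^i_x`. -/
def uJet {n : ℕ} (y : Jet ℕ n) : Jet ℕ n := fun p => y (p.1 + 1, p.2)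

/-- The `φ`-jets whose `u`-jet lies in `Ω`. -/
def potDomain {n : ℕ} (Ω : Set (Jet ℕ n)) : Set (Jet ℕ n) := {y | uJet y ∈ Ω}

/-- A vector function of `u, u_x, …` written in the potential variables. -/
def VecFun.toPot {n : ℕ} (X : VecFun n) : VecFun n := fun i y => X i (uJet y)

/-- An operator with coefficients in `u, u_x, …` written in the potential variables. -/
def DiffOp.toPot {n : ℕ} (P : DiffOp n) : DiffOp n := fun σ i j y => P σ i j (uJet y)

/-- The `x`-jet of `φ` contained in an `(x, t)`-jet of `φ`. -/
def xJet {n : ℕ} (w : Jet (ℕ × ℕ) n) : Jet ℕ n := fun p => w ((p.1, 0), p.2)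

/-- The bi-Hamiltonian hierarchy of `A₁ = K ∂_x` and `A₂` with Hamiltonian densities `h k`, in
potential variables:
`φ^i_{x t^k} = -A₂^{is} ∂_x⁻¹ (δH_k/δφ^s) = -K^{is} δH_{k+1}/δφ^s`.
The covector `q k` is `∂_x⁻¹ (δH_k/δφ)`, that is, `-δH_k/δu`. Densities may depend on `φ` itself
(so on `∂_x⁻¹ u`). -/
def IsHierarchy {n : ℕ} (Ω : Set (Jet ℕ n)) (K : Matrix (Fin n) (Fin n) ℝ) (A₂ : DiffOp n)
    (h : ℕ → Jet ℕ n → ℝ) : Prop :=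
  (∀ k, IsDiffFun (potDomain Ω) (h k)) ∧
  ∃ q : ℕ → VecFun n, ∀ k, IsDiffVec (potDomain Ω) (q k) ∧
    (∀ i, ∀ y ∈ potDomain Ω, Dx (q k i) y = euler (h k) i y) ∧
    (∀ i, ∀ y ∈ potDomain Ω, A₂.toPot.app (q k) i y = ∑ s, K i s * euler (h (k + 1)) s y)

/-- The operator `B_{ij} = -M_{ip} A₂^{pq} M_{qj}` in potential variables, `M = K⁻¹`. -/
def symplecticOp {n : ℕ} (K : Matrix (Fin n) (Fin n) ℝ) (A₂ : DiffOp n) : DiffOp n :=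
  fun σ i j y => -∑ p, ∑ q, K⁻¹ i p * A₂.toPot σ p q y * K⁻¹ q j

/-- The left-hand side `B_{im} φ^m_t - δH/δφ^i` of the system `B_{im} φ^m_t = δH/δφ^i`. -/
def symplecticSystem {n : ℕ} (K : Matrix (Fin n) (Fin n) ℝ) (A₂ : DiffOp n) (H : Jet ℕ n → ℝ)
    (i : Fin n) (w : Jet (ℕ × ℕ) n) : ℝ :=
  (∑ m, ∑ᶠ σ : ℕ, symplecticOp K A₂ σ i m (xJet w) * w ((σ, 1), m)) - euler H i (xJet w)

/-- The Lagrangian density `L_m φ^m_t - H`. -/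
def lagrangian {n : ℕ} (L : VecFun n) (H : Jet ℕ n → ℝ) : Jet (ℕ × ℕ) n → ℝ :=
  fun w => (∑ m, L m (xJet w) * w ((0, 1), m)) - H (xJet w)

/-- `L_m φ^m_{t^k} - h_{k+2}`, for all `k`, is a Lagrangian representation of the hierarchy with
densities `h`: its Euler–Lagrange expression is that of the system
`B_{im} φ^m_{t^k} = δH_{k+2}/δφ^i`. Here `L` is a function of the `φ`-jet. -/
def IsLagrangianRep {n : ℕ} (Ω : Set (Jet ℕ n)) (K : Matrix (Fin n) (Fin n) ℝ) (A₂ : DiffOp n)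
    (h : ℕ → Jet ℕ n → ℝ) (L : VecFun n) : Prop :=
  IsDiffVec (potDomain Ω) L ∧
  ∀ k i, ∀ w : Jet (ℕ × ℕ) n, xJet w ∈ potDomain Ω →
    eulerXT (lagrangian L (h (k + 2))) i w = symplecticSystem K A₂ (h (k + 2)) i w

/-- The generalized vector field `τ^i = K^{ij} ψ_j` with `ψ = -L`. -/
def tauOf {n : ℕ} (K : Matrix (Fin n) (Fin n) ℝ) (L : VecFun n) : VecFun n :=
  fun i z => ∑ j, K i j * (-L j z)

end VarCalc

end

open VarCalc

/-!
Write `u = φ_x`, so that `∂/∂φ_{σ+1} = ∂/∂u_σ` on functions of the `u`-jet. For `L` a function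
of `u, u_x, …` with linearization `ℓ_L` with respect to `u`, the linearization with respect to `φ`
is `ℓ_L ∘ ∂_x`, and its adjoint is `-∂_x ∘ ℓ_L^*`. Hence the Euler–Lagrange expression of
`L_m φ^m_t - H` is `-(ℓ_L ∘ ∂_x + ∂_x ∘ ℓ_L^*)(φ_t) - δH/δφ` (`eulerXT_lagrangian`), and `L` is a
Lagrangian representation exactly when `ℓ_L ∘ ∂_x + ∂_x ∘ ℓ_L^* = K⁻¹ A₂ K⁻¹` on `φ_t`
(`isLagrangianRep_iff`); the Hamiltonians drop out. On the other side, `K ∂_x` has constant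
coefficients, so for `τ = -K L` its Lie derivative is `K (ℓ_L ∘ ∂_x + ∂_x ∘ ℓ_L^*) K`
(`lieDeriv_tauOf_constOp`), and the condition `A₂ = L_τ (K ∂_x)` is the same operator identity,
tested on covectors `η` in place of `φ_t` (`isLieDerivOf_iff`).

What remains is to compare an identity in the jet coordinates of `φ_t` with an identity for all
covectors. Both directions use maps from `x`-jets to `(x, t)`-jets which commute with total
derivatives (`IsHolonomic`); pullback along such a map commutes with the iterated total
derivatives in the adjoints, so no Leibniz expansion is needed. The map `graphJet η` substitutes
`φ_t = η` and gives the covector identity from the jet identity. Conversely `relabelJet s`, which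
imposes `∂_t = ∂_x^s`, comes from the covector `η = u_{s-1}`. For large `s` it reaches any given values
of the finitely many coordinates involved; these points remain in the domain because an open set
in the product topology constrains only finitely many coordinates near a point
(`eq_zero_of_relabelJet`).

Since `K` is invertible, `L ↦ -K L` is a bijection of the smooth vector functions, which gives
the remaining claims.
-/

namespace VarCalc

/-! ### Calculus of differential functions on an open set of jets -/

open Topology in
/-- An open set of jets has open projections to finitely many coordinates, so the smooth functions
that represent differential functions are differentiable at the points that matter. -/
theorem image_restrict_mem_nhds {S : Type} {n : ℕ} {Ω : Set (Jet S n)} (hΩ : IsOpen Ω)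
    (P : Finset (S × Fin n)) {z : Jet S n} (hz : z ∈ Ω) :
    (fun (z : Jet S n) (p : P) => z p) '' Ω ∈ 𝓝 (fun p : P => z p) := by
  classical
  -- Fill in the coordinates outside `P` from `z`; this is a continuous local section.
  let ext : (P → ℝ) → Jet S n := fun x p => if hp : p ∈ P then x ⟨p, hp⟩ else z p
  have hcont : Continuous ext := by
    refine continuous_pi fun p => ?_
    by_cases hp : p ∈ P
    · simpa [ext, hp] using continuous_apply (⟨p, hp⟩ : P)
    · simpa [ext, hp] using continuous_const
  have hext : ext (fun p : P => z p) = z := by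
    funext p
    by_cases hp : p ∈ P <;> simp [ext, hp]
  have hmem : ext ⁻¹' Ω ∈ 𝓝 (fun p : P => z p) :=
    (hΩ.preimage hcont).mem_nhds (by simpa [hext] using hz)
  refine Filter.mem_of_superset hmem fun x hx => ⟨ext x, hx, ?_⟩
  funext p
  simp [ext]

theorem isOpen_image_restrict {S : Type} {n : ℕ} {Ω : Set (Jet S n)} (hΩ : IsOpen Ω)
    (P : Finset (S × Fin n)) : IsOpen ((fun (z : Jet S n) (p : P) => z p) '' Ω) := by
  rw [isOpen_iff_mem_nhds]
  rintro _ ⟨z, hz, rfl⟩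
  exact image_restrict_mem_nhds hΩ P hz

namespace IsDiffFun

variable {S : Type} {n : ℕ} {Ω : Set (Jet S n)}

/-- A smooth function of finitely many differential functions is a differential function. -/
theorem of_comp {ι : Type*} [Fintype ι] {F : (ι → ℝ) → ℝ} {U : Set (ι → ℝ)}
    (hF : ContDiffOn ℝ ∞ F U) {a : ι → Jet S n → ℝ} (ha : ∀ i, IsDiffFun Ω (a i))
    (hU : ∀ z ∈ Ω, (fun i => a i z) ∈ U) {f : Jet S n → ℝ}
    (hf : ∀ z ∈ Ω, f z = F (fun i => a i z)) : IsDiffFun Ω f := by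
  classical
  choose P g hg hag using ha
  let Q : Finset (S × Fin n) := Finset.univ.biUnion P
  have hPQ : ∀ i, ∀ p ∈ P i, p ∈ Q := fun i p hp =>
    Finset.mem_biUnion.2 ⟨i, Finset.mem_univ i, hp⟩
  let r : ∀ i, (Q → ℝ) → (P i → ℝ) := fun i x p => x ⟨p, hPQ i p p.2⟩
  refine ⟨Q, fun x => F fun i => g i (r i x), ?_, fun z hz => ?_⟩
  · refine hF.comp (t := U) (contDiffOn_pi.2 fun i => ?_) ?_
    · refine (hg i).comp (contDiff_pi.2 fun p => contDiff_apply ℝ ℝ _).contDiffOn ?_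
      rintro _ ⟨z, hz, rfl⟩
      exact ⟨z, hz, rfl⟩
    · rintro _ ⟨z, hz, rfl⟩
      have h := hU z hz
      simp only [hag _ z hz] at h
      exact h
  · rw [hf z hz]
    congr 1
    funext i
    exact hag i z hz

theorem coord (Ω : Set (Jet S n)) (p : S × Fin n) : IsDiffFun Ω (fun z => z p) :=
  ⟨{p}, fun x => x ⟨p, by simp⟩, (contDiff_apply ℝ ℝ _).contDiffOn, fun _ _ => rfl⟩

theorem const (Ω : Set (Jet S n)) (c : ℝ) : IsDiffFun Ω (fun _ => c) :=
  ⟨∅, fun _ => c, contDiffOn_const, fun _ _ => rfl⟩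

theorem congr {f g : Jet S n → ℝ} (hf : IsDiffFun Ω f) (h : Set.EqOn g f Ω) :
    IsDiffFun Ω g := by
  obtain ⟨P, G, hG, hfG⟩ := hf
  exact ⟨P, G, hG, fun z hz => (h hz).trans (hfG z hz)⟩

theorem mul {f g : Jet S n → ℝ} (hf : IsDiffFun Ω f) (hg : IsDiffFun Ω g) :
    IsDiffFun Ω (fun z => f z * g z) := by
  refine of_comp (ι := Fin 2) (F := fun x => x 0 * x 1) (U := Set.univ) (a := ![f, g])
    ?_ ?_ (fun _ _ => trivial) (fun z _ => rfl)
  · exact ((contDiff_apply ℝ ℝ _).mul (contDiff_apply ℝ ℝ _)).contDiffOn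
  · intro i
    fin_cases i
    exacts [hf, hg]

theorem sum {ι : Type*} (T : Finset ι) {f : ι → Jet S n → ℝ}
    (hf : ∀ i ∈ T, IsDiffFun Ω (f i)) : IsDiffFun Ω (fun z => ∑ i ∈ T, f i z) := by
  refine of_comp (ι := T) (F := fun x => ∑ i, x i) (U := Set.univ) (a := fun i => f i)
    ?_ (fun i => hf i i.2) (fun _ _ => trivial) (fun z _ => ?_)
  · exact (ContDiff.sum fun i _ => contDiff_apply ℝ ℝ i).contDiffOn
  · exact (Finset.sum_coe_sort T fun i => f i z).symm

theorem const_mul {f : Jet S n → ℝ} (c : ℝ) (hf : IsDiffFun Ω f) :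
    IsDiffFun Ω (fun z => c * f z) := (const Ω c).mul hf

theorem add {f g : Jet S n → ℝ} (hf : IsDiffFun Ω f) (hg : IsDiffFun Ω g) :
    IsDiffFun Ω (fun z => f z + g z) := by
  refine of_comp (ι := Fin 2) (F := fun x => x 0 + x 1) (U := Set.univ) (a := ![f, g])
    ?_ ?_ (fun _ _ => trivial) (fun z _ => rfl)
  · exact ((contDiff_apply ℝ ℝ _).add (contDiff_apply ℝ ℝ _)).contDiffOn
  · intro i
    fin_cases i
    exacts [hf, hg]

theorem sub {f g : Jet S n → ℝ} (hf : IsDiffFun Ω f) (hg : IsDiffFun Ω g) :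
    IsDiffFun Ω (fun z => f z - g z) := by
  refine of_comp (ι := Fin 2) (F := fun x => x 0 - x 1) (U := Set.univ) (a := ![f, g])
    ?_ ?_ (fun _ _ => trivial) (fun z _ => rfl)
  · exact ((contDiff_apply ℝ ℝ _).sub (contDiff_apply ℝ ℝ _)).contDiffOn
  · intro i
    fin_cases i
    exacts [hf, hg]

theorem comp {S' : Type} {n' : ℕ} {Ω' : Set (Jet S' n')} {f : Jet S' n' → ℝ}
    (hf : IsDiffFun Ω' f) {Φ : Jet S n → Jet S' n'} (hΦ : ∀ q, IsDiffFun Ω (fun z => Φ z q))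
    (hmaps : Set.MapsTo Φ Ω Ω') : IsDiffFun Ω (fun z => f (Φ z)) := by
  obtain ⟨P, g, hg, hfg⟩ := hf
  exact of_comp hg (a := fun (q : P) z => Φ z q) (fun q => hΦ q)
    (fun z hz => ⟨Φ z, hmaps hz, rfl⟩) (fun z hz => hfg _ (hmaps hz))

end IsDiffFun

section PartialDerivatives

variable {S : Type} [DecidableEq S] {n : ℕ} {Ω : Set (Jet S n)}

open Topology in
theorem eventually_update_mem (hΩ : IsOpen Ω) {z : Jet S n} (hz : z ∈ Ω) (p : S × Fin n) :
    ∀ᶠ s in 𝓝 (z p), Function.update z p s ∈ Ω := by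
  have hc : Continuous fun s : ℝ => Function.update z p s := continuous_const.update p continuous_id
  exact (hΩ.preimage hc).mem_nhds (by simpa using hz)

theorem pd_congr (hΩ : IsOpen Ω) (p : S × Fin n) {f g : Jet S n → ℝ} (h : Set.EqOn f g Ω) :
    Set.EqOn (pd p f) (pd p g) Ω := fun _ hz =>
  Filter.EventuallyEq.deriv_eq ((eventually_update_mem hΩ hz p).mono fun _ hs => h hs)

theorem hasDerivAt_coord (z : Jet S n) (p q : S × Fin n) :
    HasDerivAt (fun s => Function.update z p s q) (if q = p then 1 else 0) (z p) := by
  by_cases h : q = p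
  · subst h
    simpa using hasDerivAt_id' (z q)
  · simpa [h] using hasDerivAt_const (z p) (z q)

theorem pd_coord (z : Jet S n) (p q : S × Fin n) :
    pd p (fun z => z q) z = if q = p then 1 else 0 := (hasDerivAt_coord z p q).deriv

open Topology in
/-- The chain rule in coordinate direction `p`, with differentiability of the inner functions
required in that direction only. -/
theorem hasDerivAt_update_of_comp (hΩ : IsOpen Ω) {ι : Type*} [Fintype ι] [DecidableEq ι]
    {F : (ι → ℝ) → ℝ} {a : ι → Jet S n → ℝ} {f : Jet S n → ℝ}
    (hf : ∀ z ∈ Ω, f z = F (fun i => a i z)) {z : Jet S n} (hz : z ∈ Ω) (p : S × Fin n)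
    (hF : DifferentiableAt ℝ F (fun i => a i z))
    (ha : ∀ i, DifferentiableAt ℝ (fun s => a i (Function.update z p s)) (z p)) :
    HasDerivAt (fun s => f (Function.update z p s))
      (∑ i, fderiv ℝ F (fun i => a i z) (Pi.single i 1) * pd p (a i) z) (z p) := by
  have hin : HasDerivAt (fun s i => a i (Function.update z p s)) (fun i => pd p (a i) z) (z p) :=
    hasDerivAt_pi.2 fun i => (ha i).hasDerivAt
  have hF' : HasFDerivAt F (fderiv ℝ F (fun i => a i z))
      ((fun s i => a i (Function.update z p s)) (z p)) := by
    simpa using hF.hasFDerivAt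
  have h := hF'.comp_hasDerivAt (z p) hin
  have hev : (fun s => f (Function.update z p s)) =ᶠ[𝓝 (z p)]
      F ∘ (fun s i => a i (Function.update z p s)) :=
    (eventually_update_mem hΩ hz p).mono fun s hs => hf _ hs
  refine (h.congr_of_eventuallyEq hev).congr_deriv ?_
  rw [← ContinuousLinearMap.coe_coe, LinearMap.pi_apply_eq_sum_univ]
  refine Finset.sum_congr rfl fun i _ => ?_
  rw [smul_eq_mul, mul_comm]
  congr 3
  funext j
  simp [Pi.single_apply, eq_comm]

theorem IsDiffFun.differentiableAt_update (hΩ : IsOpen Ω) {f : Jet S n → ℝ}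
    (hf : IsDiffFun Ω f) {z : Jet S n} (hz : z ∈ Ω) (p : S × Fin n) :
    DifferentiableAt ℝ (fun s => f (Function.update z p s)) (z p) := by
  obtain ⟨P, g, hg, hfg⟩ := hf
  exact (hasDerivAt_update_of_comp hΩ (a := fun (q : P) z => z q) hfg hz p
    ((hg.contDiffAt (image_restrict_mem_nhds hΩ P hz)).differentiableAt (by simp))
    fun q => (hasDerivAt_coord z p q).differentiableAt).differentiableAt

theorem pd_eq_fderiv (hΩ : IsOpen Ω) {f : Jet S n → ℝ} {P : Finset (S × Fin n)}
    {g : (P → ℝ) → ℝ} (hg : ContDiffOn ℝ ∞ g ((fun (z : Jet S n) (p : P) => z p) '' Ω))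
    (hfg : ∀ z ∈ Ω, f z = g (fun p => z p)) {z : Jet S n} (hz : z ∈ Ω) (p : P) :
    pd (p : S × Fin n) f z = fderiv ℝ g (fun q => z q) (Pi.single p 1) := by
  refine (hasDerivAt_update_of_comp hΩ (a := fun (q : P) z => z q) hfg hz p
    ((hg.contDiffAt (image_restrict_mem_nhds hΩ P hz)).differentiableAt (by simp))
    fun q => (hasDerivAt_coord z p q).differentiableAt).deriv.trans ?_
  simp only [pd_coord, Subtype.coe_inj, mul_ite, mul_one, mul_zero, Finset.sum_ite_eq',
    Finset.mem_univ, if_true]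

theorem pd_eq_zero_of_notMem (hΩ : IsOpen Ω) {f : Jet S n → ℝ} {P : Finset (S × Fin n)}
    {g : (P → ℝ) → ℝ} (hfg : ∀ z ∈ Ω, f z = g (fun p => z p)) {z : Jet S n} (hz : z ∈ Ω)
    {p : S × Fin n} (hp : p ∉ P) : pd p f z = 0 := by
  have hev := (eventually_update_mem hΩ hz p).mono fun s hs => hfg _ hs
  refine (Filter.EventuallyEq.deriv_eq (f := fun _ => g fun q => z q) ?_).trans
    (deriv_const _ _)
  refine hev.mono fun s hs => hs.trans ?_
  congr 1
  funext q
  exact Function.update_of_ne (by rintro rfl; exact hp q.2) _ _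

theorem IsDiffFun.pd (hΩ : IsOpen Ω) {f : Jet S n → ℝ} (hf : IsDiffFun Ω f)
    (p : S × Fin n) : IsDiffFun Ω (pd p f) := by
  obtain ⟨P, g, hg, hfg⟩ := hf
  by_cases hp : p ∈ P
  · refine ⟨P, fun x => fderiv ℝ g x (Pi.single ⟨p, hp⟩ 1), ?_, fun z hz =>
      pd_eq_fderiv hΩ hg hfg hz ⟨p, hp⟩⟩
    exact (hg.fderiv_of_isOpen (isOpen_image_restrict hΩ P) (by simp)).clm_apply
      contDiffOn_const
  · exact (IsDiffFun.const Ω 0).congr fun z hz => pd_eq_zero_of_notMem hΩ hfg hz hp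

theorem IsDiffFun.exists_pd_eq_zero (hΩ : IsOpen Ω) {f : Jet S n → ℝ} (hf : IsDiffFun Ω f) :
    ∃ P : Finset (S × Fin n), ∀ p ∉ P, ∀ z ∈ Ω, VarCalc.pd p f z = 0 := by
  obtain ⟨P, g, hg, hfg⟩ := hf
  exact ⟨P, fun p hp z hz => pd_eq_zero_of_notMem hΩ hfg hz hp⟩

theorem pd_mul (hΩ : IsOpen Ω) {f g : Jet S n → ℝ} (hf : IsDiffFun Ω f) (hg : IsDiffFun Ω g)
    (p : S × Fin n) {z : Jet S n} (hz : z ∈ Ω) :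
    pd p (fun z => f z * g z) z = pd p f z * g z + f z * pd p g z := by
  have := (hf.differentiableAt_update hΩ hz p).hasDerivAt.fun_mul
    (hg.differentiableAt_update hΩ hz p).hasDerivAt
  simpa [pd] using this.deriv

theorem pd_sub (hΩ : IsOpen Ω) {f g : Jet S n → ℝ} (hf : IsDiffFun Ω f) (hg : IsDiffFun Ω g)
    (p : S × Fin n) {z : Jet S n} (hz : z ∈ Ω) :
    pd p (fun z => f z - g z) z = pd p f z - pd p g z :=
  deriv_fun_sub (hf.differentiableAt_update hΩ hz p) (hg.differentiableAt_update hΩ hz p)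

theorem pd_sum (hΩ : IsOpen Ω) {ι : Type*} (T : Finset ι) {f : ι → Jet S n → ℝ}
    (hf : ∀ i ∈ T, IsDiffFun Ω (f i)) (p : S × Fin n) {z : Jet S n} (hz : z ∈ Ω) :
    pd p (fun z => ∑ i ∈ T, f i z) z = ∑ i ∈ T, pd p (f i) z :=
  deriv_fun_sum fun i hi => (hf i hi).differentiableAt_update hΩ hz p

theorem pd_const_mul (c : ℝ) (f : Jet S n → ℝ) (p : S × Fin n) (z : Jet S n) :
    pd p (fun z => c * f z) z = c * pd p f z := by
  simp [pd]

end PartialDerivatives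

/-! ### Total derivatives and holonomic maps -/

section TotalDerivative

variable {S : Type} [DecidableEq S] [Add S] {n : ℕ} {Ω : Set (Jet S n)}

theorem totalD_eq_sum {f : Jet S n → ℝ} {P : Finset (S × Fin n)} {z : Jet S n}
    (hP : ∀ p ∉ P, pd p f z = 0) (e : S) :
    totalD e f z = ∑ p ∈ P, pd p f z * z (p.1 + e, p.2) := by
  refine finsum_eq_sum_of_support_subset _ fun p hp => ?_
  by_contra h
  exact hp (by simp [hP p h])

theorem totalD_congr (hΩ : IsOpen Ω) (e : S) {f g : Jet S n → ℝ} (h : Set.EqOn f g Ω) :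
    Set.EqOn (totalD e f) (totalD e g) Ω := fun z hz =>
  finsum_congr fun p => by rw [pd_congr hΩ p h hz]

theorem totalD_iterate_congr (hΩ : IsOpen Ω) (e : S) {f g : Jet S n → ℝ} (h : Set.EqOn f g Ω)
    (k : ℕ) : Set.EqOn ((totalD e)^[k] f) ((totalD e)^[k] g) Ω := by
  induction k with
  | zero => exact h
  | succ k ih =>
    simp only [Function.iterate_succ_apply']
    exact totalD_congr hΩ e ih

theorem IsDiffFun.totalD (hΩ : IsOpen Ω) {f : Jet S n → ℝ} (hf : IsDiffFun Ω f) (e : S) :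
    IsDiffFun Ω (totalD e f) := by
  obtain ⟨P, hP⟩ := hf.exists_pd_eq_zero hΩ
  exact (IsDiffFun.sum P fun p _ => (hf.pd hΩ p).mul (IsDiffFun.coord Ω (p.1 + e, p.2))).congr
    fun z hz => totalD_eq_sum (fun p hp => hP p hp z hz) e

theorem IsDiffFun.totalD_iterate (hΩ : IsOpen Ω) {f : Jet S n → ℝ} (hf : IsDiffFun Ω f) (e : S)
    (k : ℕ) : IsDiffFun Ω ((VarCalc.totalD e)^[k] f) := by
  induction k with
  | zero => exact hf
  | succ k ih =>
    rw [Function.iterate_succ_apply']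
    exact ih.totalD hΩ e

theorem totalD_coord (z : Jet S n) (e : S) (q : S × Fin n) :
    totalD e (fun z => z q) z = z (q.1 + e, q.2) := by
  rw [totalD_eq_sum (P := {q}) (fun p hp => ?_)]
  · simp [pd_coord]
  · rw [pd_coord, if_neg]
    rintro rfl
    simp at hp

theorem totalD_const_mul (e : S) (c : ℝ) (f : Jet S n → ℝ) (z : Jet S n) :
    totalD e (fun z => c * f z) z = c * totalD e f z := by
  simp only [totalD, pd_const_mul, mul_assoc]
  exact (smul_finsum c _).symm

theorem totalD_sum (hΩ : IsOpen Ω) (e : S) {ι : Type*} (T : Finset ι) {f : ι → Jet S n → ℝ}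
    (hf : ∀ i ∈ T, IsDiffFun Ω (f i)) {z : Jet S n} (hz : z ∈ Ω) :
    totalD e (fun z => ∑ i ∈ T, f i z) z = ∑ i ∈ T, totalD e (f i) z := by
  classical
  choose! P hP using fun i (hi : i ∈ T) => (hf i hi).exists_pd_eq_zero hΩ
  have h0 : ∀ i ∈ T, ∀ p ∉ T.biUnion P, pd p (f i) z = 0 := fun i hi p hp =>
    hP i hi p (fun h => hp (Finset.mem_biUnion.2 ⟨i, hi, h⟩)) z hz
  rw [totalD_eq_sum (P := T.biUnion P) fun p hp => by
    rw [pd_sum hΩ T hf p hz, Finset.sum_eq_zero fun i hi => h0 i hi p hp]]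
  rw [Finset.sum_congr rfl fun i hi => totalD_eq_sum (h0 i hi) e, Finset.sum_comm]
  exact Finset.sum_congr rfl fun p _ => by rw [pd_sum hΩ T hf p hz, Finset.sum_mul]

theorem totalD_sub (hΩ : IsOpen Ω) (e : S) {f g : Jet S n → ℝ} (hf : IsDiffFun Ω f)
    (hg : IsDiffFun Ω g) {z : Jet S n} (hz : z ∈ Ω) :
    totalD e (fun z => f z - g z) z = totalD e f z - totalD e g z := by
  classical
  obtain ⟨P, hP⟩ := hf.exists_pd_eq_zero hΩ
  obtain ⟨Q, hQ⟩ := hg.exists_pd_eq_zero hΩ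
  have hP' : ∀ p ∉ P ∪ Q, pd p f z = 0 := fun p hp =>
    hP p (fun h => hp (Finset.mem_union_left _ h)) z hz
  have hQ' : ∀ p ∉ P ∪ Q, pd p g z = 0 := fun p hp =>
    hQ p (fun h => hp (Finset.mem_union_right _ h)) z hz
  rw [totalD_eq_sum (P := P ∪ Q) fun p hp => by rw [pd_sub hΩ hf hg p hz, hP' p hp, hQ' p hp,
    sub_zero], totalD_eq_sum hP', totalD_eq_sum hQ', ← Finset.sum_sub_distrib]
  exact Finset.sum_congr rfl fun p _ => by rw [pd_sub hΩ hf hg p hz, sub_mul]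

theorem totalD_iterate_const_mul (e : S) (c : ℝ) (f : Jet S n → ℝ) (k : ℕ) :
    (totalD e)^[k] (fun z => c * f z) = fun z => c * (totalD e)^[k] f z := by
  induction k with
  | zero => rfl
  | succ k ih =>
    simp only [Function.iterate_succ_apply', ih]
    exact funext fun z => totalD_const_mul e c _ z

theorem totalD_iterate_sum (hΩ : IsOpen Ω) (e : S) {ι : Type*} (T : Finset ι)
    {f : ι → Jet S n → ℝ} (hf : ∀ i ∈ T, IsDiffFun Ω (f i)) (k : ℕ) :
    Set.EqOn ((totalD e)^[k] (fun z => ∑ i ∈ T, f i z))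
      (fun z => ∑ i ∈ T, (totalD e)^[k] (f i) z) Ω := by
  induction k with
  | zero => exact fun _ _ => rfl
  | succ k ih =>
    simp only [Function.iterate_succ_apply']
    exact fun z hz => (totalD_congr hΩ e ih hz).trans
      (totalD_sum hΩ e T (fun i hi => (hf i hi).totalD_iterate hΩ e k) hz)

theorem totalD_iterate_sub (hΩ : IsOpen Ω) (e : S) {f g : Jet S n → ℝ} (hf : IsDiffFun Ω f)
    (hg : IsDiffFun Ω g) (k : ℕ) :
    Set.EqOn ((totalD e)^[k] (fun z => f z - g z))
      (fun z => (totalD e)^[k] f z - (totalD e)^[k] g z) Ω := by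
  induction k with
  | zero => exact fun _ _ => rfl
  | succ k ih =>
    simp only [Function.iterate_succ_apply']
    exact fun z hz => (totalD_congr hΩ e ih hz).trans
      (totalD_sub hΩ e (hf.totalD_iterate hΩ e k) (hg.totalD_iterate hΩ e k) hz)

theorem totalD_iterate_linearCombination (hΩ : IsOpen Ω) (e : S) {ι : Type*} (T : Finset ι)
    (c : ι → ℝ) {f : ι → Jet S n → ℝ} (hf : ∀ i ∈ T, IsDiffFun Ω (f i)) {F : Jet S n → ℝ}
    (hF : ∀ z ∈ Ω, F z = ∑ i ∈ T, c i * f i z) (k : ℕ) {z : Jet S n} (hz : z ∈ Ω) :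
    (totalD e)^[k] F z = ∑ i ∈ T, c i * (totalD e)^[k] (f i) z := by
  rw [totalD_iterate_congr hΩ e (g := fun z => ∑ i ∈ T, c i * f i z) hF k hz,
    totalD_iterate_sum hΩ e T (fun i hi => (hf i hi).const_mul (c i)) k hz]
  exact Finset.sum_congr rfl fun i _ => congrFun (totalD_iterate_const_mul e _ _ k) z

theorem totalD_iterate_eq_zero (hΩ : IsOpen Ω) (e : S) {f : Jet S n → ℝ}
    (hf : ∀ z ∈ Ω, f z = 0) (k : ℕ) {z : Jet S n} (hz : z ∈ Ω) : (totalD e)^[k] f z = 0 := by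
  have h : Set.EqOn f (fun z => (0 : ℝ) * f z) Ω := fun z hz =>
    (hf z hz).trans (zero_mul _).symm
  rw [totalD_iterate_congr hΩ e h k hz, totalD_iterate_const_mul]
  exact zero_mul _

variable {S' : Type} [DecidableEq S'] {n' : ℕ} {Ω' : Set (Jet S' n')}

/-- The chain rule for total derivatives. -/
theorem totalD_comp (hΩ : IsOpen Ω) (hΩ' : IsOpen Ω') {Φ : Jet S n → Jet S' n'}
    (hΦ : ∀ q, IsDiffFun Ω (fun z => Φ z q)) (hmaps : Set.MapsTo Φ Ω Ω') {f : Jet S' n' → ℝ}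
    (hf : IsDiffFun Ω' f) (e : S) {z : Jet S n} (hz : z ∈ Ω) :
    totalD e (fun z => f (Φ z)) z = ∑ᶠ q, pd q f (Φ z) * totalD e (fun z => Φ z q) z := by
  classical
  obtain ⟨P, g, hg, hfg⟩ := hf
  choose Q hQ using fun q => (hΦ q).exists_pd_eq_zero hΩ
  have hz' := hmaps hz
  have hpd : ∀ p, pd p (fun z => f (Φ z)) z =
      ∑ q ∈ P, pd q f (Φ z) * pd p (fun z => Φ z q) z := fun p => by
    rw [← Finset.sum_coe_sort]
    simp only [pd_eq_fderiv hΩ' hg hfg hz']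
    exact (hasDerivAt_update_of_comp hΩ (a := fun (q : P) z => Φ z q)
      (f := fun z => f (Φ z)) (fun z hz => hfg _ (hmaps hz)) hz p
      ((hg.contDiffAt (image_restrict_mem_nhds hΩ' P hz')).differentiableAt (by simp))
      fun q => (hΦ q).differentiableAt_update hΩ hz p).deriv
  have hQ0 : ∀ q ∈ P, ∀ p ∉ P.biUnion Q, pd p (fun z => Φ z q) z = 0 := fun q hq p hp =>
    hQ q p (fun h => hp (Finset.mem_biUnion.2 ⟨q, hq, h⟩)) z hz
  rw [totalD_eq_sum (P := P.biUnion Q) fun p hp => by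
    rw [hpd, Finset.sum_eq_zero fun q hq => by rw [hQ0 q hq p hp, mul_zero]]]
  rw [finsum_eq_sum_of_support_subset (s := P) _ fun q hq => by
    by_contra h
    exact hq (by simp [pd_eq_zero_of_notMem hΩ' hfg hz' h])]
  simp only [hpd, Finset.sum_mul]
  rw [Finset.sum_comm]
  refine Finset.sum_congr rfl fun q hq => ?_
  rw [totalD_eq_sum (hQ0 q hq) e, Finset.mul_sum]
  exact Finset.sum_congr rfl fun p _ => mul_assoc _ _ _

variable [Add S']

/-- A map of jets which respects the prolongation structure: the pulled-back coordinates are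
differential functions, and the total derivative in direction `e` shifts their multi-indices
by `e'`. -/
structure IsHolonomic (Ω : Set (Jet S n)) (Ω' : Set (Jet S' n')) (e : S) (e' : S')
    (Φ : Jet S n → Jet S' n') : Prop where
  mapsTo : Set.MapsTo Φ Ω Ω'
  isDiffFun : ∀ q, IsDiffFun Ω (fun z => Φ z q)
  totalD_eq : ∀ q, ∀ z ∈ Ω, totalD e (fun z => Φ z q) z = Φ z (q.1 + e', q.2)

namespace IsHolonomic

variable {e : S} {e' : S'} {Φ : Jet S n → Jet S' n'}

/-- Total derivatives commute with pullback along a holonomic map. -/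
theorem totalD_iterate_comp (h : IsHolonomic Ω Ω' e e' Φ) (hΩ : IsOpen Ω) (hΩ' : IsOpen Ω')
    {f : Jet S' n' → ℝ} (hf : IsDiffFun Ω' f) (k : ℕ) :
    Set.EqOn ((totalD e)^[k] (fun z => f (Φ z))) (fun z => (totalD e')^[k] f (Φ z)) Ω := by
  induction k with
  | zero => exact fun _ _ => rfl
  | succ k ih =>
    intro z hz
    simp only [Function.iterate_succ_apply']
    rw [totalD_congr hΩ e ih hz,
      totalD_comp hΩ hΩ' h.isDiffFun h.mapsTo (hf.totalD_iterate hΩ' e' k) e hz]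
    exact finsum_congr fun q => by rw [h.totalD_eq q z hz]

end IsHolonomic

end TotalDerivative

/-- A differential function depends on finitely many coordinates, and so does membership in an
open set of jets. -/
theorem IsDiffFun.exists_finset_congr {S : Type} {n : ℕ} {Ω : Set (Jet S n)} (hΩ : IsOpen Ω)
    {f : Jet S n → ℝ} (hf : IsDiffFun Ω f) {z : Jet S n} (hz : z ∈ Ω) :
    ∃ P : Finset (S × Fin n), ∀ z', (∀ p ∈ P, z' p = z p) → z' ∈ Ω ∧ f z' = f z := by
  classical
  obtain ⟨P, g, -, hfg⟩ := hf
  obtain ⟨Q, U, hU, hQ⟩ := isOpen_pi_iff.1 hΩ z hz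
  refine ⟨P ∪ Q, fun z' h => ?_⟩
  have hz' : z' ∈ Ω := hQ fun q hq => by
    rw [h q (Finset.mem_union_right _ hq)]
    exact (hU q hq).2
  refine ⟨hz', ?_⟩
  rw [hfg z hz, hfg z' hz']
  congr 1
  funext p
  exact h p (Finset.mem_union_left _ p.2)

/-! ### Passage between `u`-jets, `φ`-jets and `(x, t)`-jets -/

section Jets

variable {n : ℕ} {Ω : Set (Jet ℕ n)}

/-- The `(x, t)`-jets of `φ` whose `u`-jet lies in `Ω`. -/
def xtDomain (Ω : Set (Jet ℕ n)) : Set (Jet (ℕ × ℕ) n) := {w | xJet w ∈ potDomain Ω}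

theorem isOpen_potDomain (hΩ : IsOpen Ω) : IsOpen (potDomain Ω) :=
  hΩ.preimage (continuous_pi fun _ => continuous_apply _)

theorem isOpen_xtDomain (hΩ : IsOpen Ω) : IsOpen (xtDomain Ω) :=
  (isOpen_potDomain hΩ).preimage (continuous_pi fun _ => continuous_apply _)

theorem isHolonomic_uJet (Ω : Set (Jet ℕ n)) : IsHolonomic (potDomain Ω) Ω 1 1 uJet where
  mapsTo _ hy := hy
  isDiffFun _ := IsDiffFun.coord _ _
  totalD_eq q y _ := totalD_coord y 1 (q.1 + 1, q.2)

theorem isHolonomic_xJet (Ω : Set (Jet ℕ n)) :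
    IsHolonomic (xtDomain Ω) (potDomain Ω) ((1, 0) : ℕ × ℕ) 1 xJet where
  mapsTo _ hw := hw
  isDiffFun _ := IsDiffFun.coord _ _
  totalD_eq q w _ := totalD_coord w (1, 0) ((q.1, 0), q.2)

theorem pd_succ_comp_uJet (f : Jet ℕ n → ℝ) (σ : ℕ) (i : Fin n) (y : Jet ℕ n) :
    pd (σ + 1, i) (fun y => f (uJet y)) y = pd (σ, i) f (uJet y) := by
  have h : ∀ s, uJet (Function.update y (σ + 1, i) s) = Function.update (uJet y) (σ, i) s := by
    intro s
    funext q
    simp [uJet, Function.update_apply, Prod.ext_iff]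
  simp only [pd, h]
  rfl

theorem pd_zero_comp_uJet (f : Jet ℕ n → ℝ) (i : Fin n) (y : Jet ℕ n) :
    pd (0, i) (fun y => f (uJet y)) y = 0 := by
  have h : ∀ s, uJet (Function.update y (0, i) s) = uJet y := by
    intro s
    funext q
    simp [uJet, Prod.ext_iff]
  simp [pd, h]

theorem pd_comp_xJet (f : Jet ℕ n → ℝ) (a b : ℕ) (i : Fin n) (w : Jet (ℕ × ℕ) n) :
    pd ((a, b), i) (fun w => f (xJet w)) w = if b = 0 then pd (a, i) f (xJet w) else 0 := by
  split_ifs with hb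
  · subst hb
    have h : ∀ s, xJet (Function.update w ((a, 0), i) s) = Function.update (xJet w) (a, i) s := by
      intro s
      funext q
      simp [xJet, Function.update_apply, Prod.ext_iff]
    simp only [pd, h]
    rfl
  · have h : ∀ s, xJet (Function.update w ((a, b), i) s) = xJet w := by
      intro s
      funext q
      simp [xJet, Prod.ext_iff, Ne.symm hb]
    simp [pd, h]

theorem totalD_t_comp_xJet (hΩ : IsOpen Ω) {f : Jet ℕ n → ℝ} (hf : IsDiffFun (potDomain Ω) f)
    {w : Jet (ℕ × ℕ) n} (hw : w ∈ xtDomain Ω) :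
    totalD ((0, 1) : ℕ × ℕ) (fun w => f (xJet w)) w =
      ∑ᶠ q : ℕ × Fin n, pd q f (xJet w) * w ((q.1, 1), q.2) := by
  rw [totalD_comp (isOpen_xtDomain hΩ) (isOpen_potDomain hΩ) (isHolonomic_xJet Ω).isDiffFun
    (isHolonomic_xJet Ω).mapsTo hf _ hw]
  exact finsum_congr fun q => by
    rw [show (fun w : Jet (ℕ × ℕ) n => xJet w q) = fun w => w ((q.1, 0), q.2) from rfl,
      totalD_coord]
    simp

theorem IsDiffVec.toPot {L : VecFun n} (hL : IsDiffVec Ω L) :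
    IsDiffVec (potDomain Ω) L.toPot := fun i =>
  (hL i).comp (isHolonomic_uJet Ω).isDiffFun (isHolonomic_uJet Ω).mapsTo

theorem exists_order_bound (hΩ : IsOpen Ω) {ι : Type*} [Fintype ι] {F : ι → Jet ℕ n → ℝ}
    (hF : ∀ m, IsDiffFun Ω (F m)) :
    ∃ N : ℕ, ∀ m, ∀ σ, N ≤ σ → ∀ i, ∀ z ∈ Ω, pd (σ, i) (F m) z = 0 := by
  choose P hP using fun m => (hF m).exists_pd_eq_zero hΩ
  refine ⟨Finset.univ.sup (fun m => (P m).sup Prod.fst) + 1, fun m σ hσ i z hz =>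
    hP m _ (fun h => ?_) z hz⟩
  have h1 : σ ≤ (P m).sup Prod.fst := Finset.le_sup (f := Prod.fst) h
  have h2 := Finset.le_sup (f := fun m => (P m).sup Prod.fst) (Finset.mem_univ m)
  exact absurd (h1.trans h2) (by omega)

theorem finsum_eq_sum_range {f : ℕ → ℝ} {N : ℕ} (h : ∀ σ, N ≤ σ → f σ = 0) :
    ∑ᶠ σ, f σ = ∑ σ ∈ Finset.range N, f σ := by
  refine finsum_eq_sum_of_support_subset _ fun σ hσ => ?_
  by_contra hc
  exact hσ (h σ (by simpa using hc))

end Jets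

/-! ### The Lie derivative of `K ∂_x` -/

section LieDerivative

variable {n : ℕ} {Ω : Set (Jet ℕ n)} {K : Matrix (Fin n) (Fin n) ℝ}

/-- The operator `ℓ_L ∘ ∂_x + ∂_x ∘ ℓ_L^*` applied to the covector `η`, for `L` of order less
than `N`. -/
noncomputable def lieForm (L : VecFun n) (N : ℕ) (η : VecFun n) (z : Jet ℕ n) (k : Fin n) : ℝ :=
  ∑ j, ∑ σ ∈ Finset.range N, pd (σ, j) (L k) z * (Dx^[σ + 1] (η j)) z +
    ∑ m, ∑ σ ∈ Finset.range N,
      (-1 : ℝ) ^ σ * (Dx^[σ + 1] (fun y => pd (σ, k) (L m) y * η m y)) z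

/-- The constant matrix `K` applied to a covector. -/
def matVec (K : Matrix (Fin n) (Fin n) ℝ) (ξ : VecFun n) : VecFun n :=
  fun m z => ∑ j, K m j * ξ j z

theorem isDiffVec_matVec (K : Matrix (Fin n) (Fin n) ℝ) {ξ : VecFun n} (hξ : IsDiffVec Ω ξ) :
    IsDiffVec Ω (matVec K ξ) := fun _ =>
  IsDiffFun.sum _ fun _ _ => (hξ _).const_mul _

theorem matVec_matVec (K M : Matrix (Fin n) (Fin n) ℝ) (ξ : VecFun n) :
    matVec K (matVec M ξ) = matVec (K * M) ξ := by
  funext m z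
  exact congrFun (Matrix.mulVec_mulVec (fun j => ξ j z) K M) m

theorem matVec_one (ξ : VecFun n) : matVec 1 ξ = ξ := by
  funext m z
  exact congrFun (Matrix.one_mulVec fun j => ξ j z) m

theorem Dx_iterate_matVec (hΩ : IsOpen Ω) {ξ : VecFun n} (hξ : IsDiffVec Ω ξ) (k : ℕ)
    (m : Fin n) {z : Jet ℕ n} (hz : z ∈ Ω) :
    (Dx^[k] (matVec K ξ m)) z = ∑ j, K m j * (Dx^[k] (ξ j)) z :=
  totalD_iterate_linearCombination hΩ 1 Finset.univ (K m) (fun _ _ => hξ _) (fun _ _ => rfl) k hz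

theorem tauOf_eq_matVec (L : VecFun n) : tauOf K L = matVec (-K) L := by
  funext i z
  simp [tauOf, matVec]

theorem constOp_app (X : VecFun n) (i : Fin n) (z : Jet ℕ n) :
    (constOp K).app X i z = ∑ j, K i j * Dx (X j) z := by
  refine Finset.sum_congr rfl fun j _ => ?_
  rw [finsum_eq_single _ 1 fun σ hσ => by simp [constOp, hσ]]
  simp [constOp]

theorem linOp_constOp_app (ξ τ : VecFun n) (i : Fin n) (z : Jet ℕ n) :
    (linOp (constOp K) ξ).app τ i z = 0 := by
  simp [DiffOp.app, linOp, constOp, pd]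

theorem pd_matVec (hΩ : IsOpen Ω) {L : VecFun n} (hL : IsDiffVec Ω L) (p : ℕ × Fin n)
    (i : Fin n) {z : Jet ℕ n} (hz : z ∈ Ω) :
    pd p (matVec K L i) z = ∑ k, K i k * pd p (L k) z :=
  (pd_sum hΩ Finset.univ (fun j _ => (hL j).const_mul (K i j)) p hz).trans
    (Finset.sum_congr rfl fun _ _ => pd_const_mul _ _ _ _)

theorem lin_tauOf_app (hΩ : IsOpen Ω) {L : VecFun n} (hL : IsDiffVec Ω L) {N : ℕ}
    (hN : ∀ m, ∀ σ, N ≤ σ → ∀ i, ∀ z ∈ Ω, pd (σ, i) (L m) z = 0)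
    {ξ : VecFun n} (hξ : IsDiffVec Ω ξ) (i : Fin n) {z : Jet ℕ n} (hz : z ∈ Ω) :
    (lin (tauOf K L)).app ((constOp K).app ξ) i z =
      -∑ k, K i k * ∑ j, ∑ σ ∈ Finset.range N,
        pd (σ, j) (L k) z * (Dx^[σ + 1] (matVec K ξ j)) z := by
  have hτ : ∀ p, pd p (tauOf K L i) z = -∑ k, K i k * pd p (L k) z := fun p => by
    rw [tauOf_eq_matVec, pd_matVec hΩ hL p i hz]
    simp
  have hD : ∀ σ j, (Dx^[σ] ((constOp K).app ξ j)) z = (Dx^[σ + 1] (matVec K ξ j)) z := by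
    intro σ j
    rw [Function.iterate_succ_apply]
    exact totalD_iterate_congr hΩ 1 (fun y hy => (constOp_app ξ j y).trans
      (Dx_iterate_matVec hΩ hξ 1 j hy).symm) σ hz
  have h1 : (lin (tauOf K L)).app ((constOp K).app ξ) i z =
      ∑ j, ∑ σ ∈ Finset.range N,
        (-∑ k, K i k * pd (σ, j) (L k) z) * (Dx^[σ + 1] (matVec K ξ j)) z := by
    refine Finset.sum_congr rfl fun j _ => ?_
    simp only [lin, hτ, hD]
    exact finsum_eq_sum_range fun σ hσ => by simp [hN _ σ hσ j z hz]
  rw [h1]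
  simp only [neg_mul, Finset.sum_neg_distrib, Finset.sum_mul, Finset.mul_sum, mul_assoc]
  rw [neg_inj, Finset.sum_comm (s := Finset.univ (α := Fin n)) (t := Finset.univ (α := Fin n))
    (f := fun k j => ∑ σ ∈ Finset.range N, K i k *
      (pd (σ, j) (L k) z * (Dx^[σ + 1] (matVec K ξ j)) z))]
  exact Finset.sum_congr rfl fun j _ => Finset.sum_comm

theorem lin_tauOf_adjApp (hΩ : IsOpen Ω) (hK : K.IsSymm) {L : VecFun n} (hL : IsDiffVec Ω L)
    {N : ℕ} (hN : ∀ m, ∀ σ, N ≤ σ → ∀ i, ∀ z ∈ Ω, pd (σ, i) (L m) z = 0)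
    {ξ : VecFun n} (hξ : IsDiffVec Ω ξ) (j : Fin n) {z : Jet ℕ n} (hz : z ∈ Ω) :
    (lin (tauOf K L)).adjApp ξ j z =
      ∑ m, ∑ σ ∈ Finset.range N, -(-1 : ℝ) ^ σ *
        (Dx^[σ] (fun y => pd (σ, j) (L m) y * matVec K ξ m y)) z := by
  have hdf : ∀ σ m i, IsDiffFun Ω (fun y => pd (σ, j) (L m) y * ξ i y) := fun σ m i =>
    ((hL m).pd hΩ _).mul (hξ i)
  have hτ : ∀ σ i, (Dx^[σ] (fun y => pd (σ, j) (tauOf K L i) y * ξ i y)) z =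
      ∑ m, -K i m * (Dx^[σ] (fun y => pd (σ, j) (L m) y * ξ i y)) z := by
    intro σ i
    refine totalD_iterate_linearCombination hΩ 1 Finset.univ (fun m => -K i m)
      (fun m _ => hdf σ m i) (fun y hy => ?_) σ hz
    simp only [tauOf_eq_matVec, pd_matVec hΩ hL _ i hy, Finset.sum_mul, mul_assoc,
      Matrix.neg_apply]
  have hη : ∀ σ m, (Dx^[σ] (fun y => pd (σ, j) (L m) y * matVec K ξ m y)) z =
      ∑ i, K m i * (Dx^[σ] (fun y => pd (σ, j) (L m) y * ξ i y)) z := by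
    intro σ m
    refine totalD_iterate_linearCombination hΩ 1 Finset.univ (fun i => K m i)
      (fun i _ => hdf σ m i) (fun y _ => ?_) σ hz
    simp only [matVec, Finset.mul_sum, mul_left_comm]
  have h0 : ∀ σ, N ≤ σ → ∀ m i, (Dx^[σ] (fun y => pd (σ, j) (L m) y * ξ i y)) z = 0 :=
    fun σ hσ m i => totalD_iterate_eq_zero hΩ 1 (fun y hy => by
      rw [hN m σ hσ j y hy, zero_mul]) σ hz
  have h1 : (lin (tauOf K L)).adjApp ξ j z = ∑ i, ∑ σ ∈ Finset.range N, (-1 : ℝ) ^ σ *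
      ∑ m, -K i m * (Dx^[σ] (fun y => pd (σ, j) (L m) y * ξ i y)) z := by
    refine Finset.sum_congr rfl fun i _ => ?_
    simp only [lin, hτ]
    exact finsum_eq_sum_range fun σ hσ => by simp [h0 σ hσ]
  rw [h1]
  simp only [hη, Finset.mul_sum]
  rw [Finset.sum_comm, Finset.sum_comm (s := Finset.univ (α := Fin n)) (t := Finset.range N)]
  refine Finset.sum_congr rfl fun σ _ => ?_
  rw [Finset.sum_comm]
  refine Finset.sum_congr rfl fun m _ => Finset.sum_congr rfl fun i _ => ?_
  rw [hK.apply i m]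
  ring

/-- With `η = K ξ`, the Lie derivative of `K ∂_x` along `τ = -K L` sends `ξ` to
`K (ℓ_L ∘ ∂_x + ∂_x ∘ ℓ_L^*) η`. -/
theorem lieDeriv_tauOf_constOp (hΩ : IsOpen Ω) (hK : K.IsSymm) {L : VecFun n}
    (hL : IsDiffVec Ω L) {N : ℕ}
    (hN : ∀ m, ∀ σ, N ≤ σ → ∀ i, ∀ z ∈ Ω, pd (σ, i) (L m) z = 0)
    {ξ : VecFun n} (hξ : IsDiffVec Ω ξ) (i : Fin n) {z : Jet ℕ n} (hz : z ∈ Ω) :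
    lieDeriv (tauOf K L) (constOp K) ξ i z = ∑ k, K i k * lieForm L N (matVec K ξ) z k := by
  have hdf : ∀ σ m k, IsDiffFun Ω (Dx^[σ] fun y => pd (σ, k) (L m) y * matVec K ξ m y) :=
    fun σ m k => (((hL m).pd hΩ _).mul (isDiffVec_matVec K hξ m)).totalD_iterate hΩ 1 σ
  have h : ∀ k, Dx ((lin (tauOf K L)).adjApp ξ k) z = -∑ m, ∑ σ ∈ Finset.range N,
      (-1 : ℝ) ^ σ * (Dx^[σ + 1] (fun y => pd (σ, k) (L m) y * matVec K ξ m y)) z := by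
    intro k
    refine (totalD_congr hΩ 1 (fun y hy => lin_tauOf_adjApp hΩ hK hL hN hξ k hy) hz).trans ?_
    refine (totalD_sum hΩ 1 Finset.univ (fun m _ => IsDiffFun.sum _ fun σ _ =>
      (hdf σ m k).const_mul _) hz).trans ?_
    rw [← Finset.sum_neg_distrib]
    refine Finset.sum_congr rfl fun m _ => ?_
    refine (totalD_sum hΩ 1 _ (fun σ _ => (hdf σ m k).const_mul _) hz).trans ?_
    rw [← Finset.sum_neg_distrib]
    refine Finset.sum_congr rfl fun σ _ => ?_
    rw [totalD_const_mul, Function.iterate_succ_apply', neg_mul]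
    rfl
  simp only [lieDeriv, linOp_constOp_app, lin_tauOf_app hΩ hL hN hξ i hz, constOp_app, h,
    lieForm, mul_add, Finset.sum_add_distrib, mul_neg, Finset.sum_neg_distrib]
  ring

end LieDerivative

/-! ### The Euler–Lagrange expression -/

section EulerLagrange

variable {n : ℕ} {Ω : Set (Jet ℕ n)} {K : Matrix (Fin n) (Fin n) ℝ}

/-- The expression `ℓ_L(∂_x φ_t) + ∂_x ℓ_L^*(φ_t)` on `(x, t)`-jets of `φ`, for `L` of order
less than `N` in `u`. -/
noncomputable def lagForm (L : VecFun n) (N : ℕ) (w : Jet (ℕ × ℕ) n) (k : Fin n) : ℝ :=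
  ∑ j, ∑ σ ∈ Finset.range N, pd (σ, j) (L k) (uJet (xJet w)) * w ((σ + 1, 1), j) +
    ∑ m, ∑ σ ∈ Finset.range N, (-1 : ℝ) ^ σ * ((totalD ((1, 0) : ℕ × ℕ))^[σ + 1]
      (fun v => pd (σ, k) (L m) (uJet (xJet v)) * v ((0, 1), m))) w

/-- The expression `A (M φ_t)` on `(x, t)`-jets of `φ`, for `A` of order less than `N`. -/
noncomputable def opForm (A : DiffOp n) (M : Matrix (Fin n) (Fin n) ℝ) (N : ℕ)
    (w : Jet (ℕ × ℕ) n) (i : Fin n) : ℝ :=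
  ∑ q, ∑ σ ∈ Finset.range N, A σ i q (uJet (xJet w)) * ∑ m, M q m * w ((σ, 1), m)

theorem isDiffFun_comp_uJet_xJet {f : Jet ℕ n → ℝ} (hf : IsDiffFun Ω f) :
    IsDiffFun (xtDomain Ω) (fun w => f (uJet (xJet w))) :=
  hf.comp (Φ := fun w => uJet (xJet w)) (fun _ => IsDiffFun.coord _ _) (fun _ hw => hw)

theorem isDiffFun_lagForm (hΩ : IsOpen Ω) {L : VecFun n} (hL : IsDiffVec Ω L) (N : ℕ)
    (k : Fin n) : IsDiffFun (xtDomain Ω) (fun w => lagForm L N w k) := by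
  have hpd : ∀ σ j m, IsDiffFun (xtDomain Ω) (fun w => pd (σ, j) (L m) (uJet (xJet w))) :=
    fun σ j m => isDiffFun_comp_uJet_xJet ((hL m).pd hΩ (σ, j))
  refine IsDiffFun.add (IsDiffFun.sum _ fun j _ => IsDiffFun.sum _ fun σ _ =>
    (hpd σ j k).mul (IsDiffFun.coord _ _)) (IsDiffFun.sum _ fun m _ => IsDiffFun.sum _ fun σ _ =>
      IsDiffFun.const_mul _ ?_)
  exact ((hpd σ k m).mul (IsDiffFun.coord _ _)).totalD_iterate (isOpen_xtDomain hΩ) _ _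

theorem isDiffFun_opForm {A : DiffOp n} (hA : IsDiffOp Ω A) (M : Matrix (Fin n) (Fin n) ℝ)
    (N : ℕ) (i : Fin n) : IsDiffFun (xtDomain Ω) (fun w => opForm A M N w i) :=
  IsDiffFun.sum _ fun q _ => IsDiffFun.sum _ fun σ _ =>
    (isDiffFun_comp_uJet_xJet (hA.1 σ i q)).mul
      (IsDiffFun.sum _ fun _ _ => (IsDiffFun.coord _ _).const_mul _)

theorem pd_lagrangian (hΩ : IsOpen Ω) {L : VecFun n} (hL : IsDiffVec Ω L) {H : Jet ℕ n → ℝ}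
    (hH : IsDiffFun (potDomain Ω) H) (a b : ℕ) (k : Fin n) {w : Jet (ℕ × ℕ) n}
    (hw : w ∈ xtDomain Ω) :
    pd ((a, b), k) (lagrangian L.toPot H) w =
      (∑ m, ((if b = 0 then pd (a, k) (L.toPot m) (xJet w) else 0) * w ((0, 1), m) +
        L.toPot m (xJet w) * if (((0, 1), m) : (ℕ × ℕ) × Fin n) = ((a, b), k) then 1 else 0)) -
      if b = 0 then pd (a, k) H (xJet w) else 0 := by
  have hX := isOpen_xtDomain hΩ
  have hLm : ∀ m, IsDiffFun (xtDomain Ω) (fun w => L.toPot m (xJet w)) := fun m =>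
    isDiffFun_comp_uJet_xJet (hL m)
  have hc : ∀ m, IsDiffFun (xtDomain Ω) (fun w : Jet (ℕ × ℕ) n => w ((0, 1), m)) := fun m =>
    IsDiffFun.coord _ _
  have hs := fun m (_ : m ∈ Finset.univ) => (hLm m).mul (hc m)
  unfold lagrangian
  rw [pd_sub hX (IsDiffFun.sum _ hs)
    (hH.comp (isHolonomic_xJet Ω).isDiffFun (isHolonomic_xJet Ω).mapsTo) _ hw,
    pd_sum hX _ hs _ hw, pd_comp_xJet]
  congr 1
  refine Finset.sum_congr rfl fun m _ => ?_
  rw [pd_mul hX (hLm m) (hc m) _ hw, pd_comp_xJet, pd_coord]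

/-- The part of the Euler–Lagrange expression which comes from `∂/∂φ_t`. -/
theorem totalD_t_toPot (hΩ : IsOpen Ω) {L : VecFun n} (hL : IsDiffVec Ω L) {N : ℕ}
    (hN : ∀ m, ∀ σ, N ≤ σ → ∀ i, ∀ z ∈ Ω, pd (σ, i) (L m) z = 0) (k : Fin n)
    {w : Jet (ℕ × ℕ) n} (hw : w ∈ xtDomain Ω) :
    totalD ((0, 1) : ℕ × ℕ) (fun w => L.toPot k (xJet w)) w =
      ∑ j, ∑ σ ∈ Finset.range N, pd (σ, j) (L k) (uJet (xJet w)) * w ((σ + 1, 1), j) := by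
  have h0 : ∀ j, pd (0, j) (L.toPot k) (xJet w) = 0 := fun j => pd_zero_comp_uJet _ _ _
  have hs : ∀ σ j, pd (σ + 1, j) (L.toPot k) (xJet w) = pd (σ, j) (L k) (uJet (xJet w)) :=
    fun σ j => pd_succ_comp_uJet _ _ _ _
  rw [totalD_t_comp_xJet hΩ (hL.toPot k) hw,
    finsum_eq_sum_of_support_subset (s := Finset.range (N + 1) ×ˢ Finset.univ) _ ?_]
  · rw [Finset.sum_product, Finset.sum_range_succ', Finset.sum_comm]
    simp only [h0, hs, zero_mul, Finset.sum_const_zero, add_zero]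
  · rintro ⟨σ, j⟩ hσ
    by_contra hc
    refine hσ ?_
    obtain ⟨τ, rfl⟩ : ∃ τ, σ = τ + 1 := ⟨σ - 1, by
      have : ¬ σ < N + 1 := fun h => hc (by simpa using h)
      omega⟩
    have hτ : N ≤ τ := by
      by_contra h
      exact hc (by simpa using h)
    simp only [hs, hN k τ hτ j _ hw, zero_mul]

/-- The Euler–Lagrange expression of `L_m φ^m_t - H`. The summand with `∂/∂φ_{σ+1}` gives the
term of order `σ` in `∂_x ℓ_L^*`, since `∂/∂φ_{σ+1} = ∂/∂u_σ`, and `∂/∂φ_t` gives `ℓ_L ∘ ∂_x`. -/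
theorem eulerXT_lagrangian (hΩ : IsOpen Ω) {L : VecFun n} (hL : IsDiffVec Ω L) {N : ℕ}
    (hN : ∀ m, ∀ σ, N ≤ σ → ∀ i, ∀ z ∈ Ω, pd (σ, i) (L m) z = 0) {H : Jet ℕ n → ℝ}
    (hH : IsDiffFun (potDomain Ω) H) (k : Fin n) {w : Jet (ℕ × ℕ) n} (hw : w ∈ xtDomain Ω) :
    eulerXT (lagrangian L.toPot H) k w = -lagForm L N w k - euler H k (xJet w) := by
  have hX := isOpen_xtDomain hΩ
  have hP := isOpen_potDomain hΩ
  obtain ⟨NH, hNH⟩ := exists_order_bound hP (F := fun _ : Unit => H) fun _ => hH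
  let G : ℕ → Fin n → Jet (ℕ × ℕ) n → ℝ := fun σ m v =>
    pd (σ, k) (L m) (uJet (xJet v)) * v ((0, 1), m)
  have hG : ∀ σ m, IsDiffFun (xtDomain Ω) (G σ m) := fun σ m =>
    (isDiffFun_comp_uJet_xJet ((hL m).pd hΩ _)).mul (IsDiffFun.coord _ _)
  have hpH : ∀ a, IsDiffFun (xtDomain Ω) (fun w => pd (a, k) H (xJet w)) := fun a =>
    (hH.pd hP _).comp (isHolonomic_xJet Ω).isDiffFun (isHolonomic_xJet Ω).mapsTo
  have hH' : ∀ a, (totalD ((1, 0) : ℕ × ℕ))^[a] (fun w => pd (a, k) H (xJet w)) w =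
      (Dx^[a] (pd (a, k) H)) (xJet w) := fun a =>
    (isHolonomic_xJet Ω).totalD_iterate_comp hX hP (hH.pd hP _) a hw
  -- `T a b` is the summand of multi-index `(a, b)`; only `T a 0` and `T 0 1` can be nonzero.
  let T : ℕ → ℕ → ℝ := fun a b => (-1 : ℝ) ^ (a + b) * ((totalD ((1, 0) : ℕ × ℕ))^[a]
    ((totalD ((0, 1) : ℕ × ℕ))^[b] (pd ((a, b), k) (lagrangian L.toPot H)))) w
  -- `L` is a function of `φ_x, φ_xx, …`, so `∂/∂φ` sees `H` only.
  have hT00 : T 0 0 = -pd (0, k) H (xJet w) := by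
    simp [T, pd_lagrangian hΩ hL hH 0 0 k hw,
      show ∀ m, pd (0, k) (L.toPot m) (xJet w) = 0 from fun m => pd_zero_comp_uJet _ _ _]
  have hTs0 : ∀ σ, T (σ + 1) 0 = -((-1 : ℝ) ^ σ * ∑ m, (totalD ((1, 0) : ℕ × ℕ))^[σ + 1]
      (G σ m) w) - (-1 : ℝ) ^ (σ + 1) * (Dx^[σ + 1] (pd (σ + 1, k) H)) (xJet w) := by
    intro σ
    have h : Set.EqOn (pd ((σ + 1, 0), k) (lagrangian L.toPot H))
        (fun w => (∑ m, G σ m w) - pd (σ + 1, k) H (xJet w)) (xtDomain Ω) := fun v hv => by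
      rw [pd_lagrangian hΩ hL hH _ _ k hv]
      simp [G, show ∀ m, pd (σ + 1, k) (L.toPot m) (xJet v) = pd (σ, k) (L m) (uJet (xJet v))
        from fun m => pd_succ_comp_uJet _ _ _ _]
    simp only [T, Function.iterate_zero, id]
    rw [totalD_iterate_congr hX _ h _ hw, totalD_iterate_sub hX _
      (IsDiffFun.sum _ fun m _ => hG σ m) (hpH _) _ hw]
    simp only [totalD_iterate_sum hX _ _ (fun m _ => hG σ m) _ hw, hH']
    ring
  have hT01 : T 0 1 = -∑ j, ∑ σ ∈ Finset.range N,
      pd (σ, j) (L k) (uJet (xJet w)) * w ((σ + 1, 1), j) := by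
    have h : Set.EqOn (pd ((0, 1), k) (lagrangian L.toPot H)) (fun w => L.toPot k (xJet w))
        (xtDomain Ω) := fun v hv => by
      rw [pd_lagrangian hΩ hL hH _ _ k hv]
      simp
    rw [← totalD_t_toPot hΩ hL hN k hw, ← totalD_congr hX _ h hw]
    simp [T]
  have hT0 : ∀ a b, b ≠ 0 → (a, b) ≠ (0, 1) → T a b = 0 := fun a b hb hab => by
    have h : ∀ v ∈ xtDomain Ω, pd ((a, b), k) (lagrangian L.toPot H) v = 0 := fun v hv => by
      rw [pd_lagrangian hΩ hL hH _ _ k hv]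
      have hne : ∀ m : Fin n, (((0, 1), m) : (ℕ × ℕ) × Fin n) ≠ ((a, b), k) := fun m h =>
        hab (congrArg Prod.fst h).symm
      simp [hb, hne]
    simp only [T]
    rw [totalD_iterate_eq_zero hX _ (fun v hv => totalD_iterate_eq_zero hX _ h b hv) a hw,
      mul_zero]
  have hG0 : ∀ σ, N ≤ σ → ∀ m, (totalD ((1, 0) : ℕ × ℕ))^[σ + 1] (G σ m) w = 0 :=
    fun σ hσ m => totalD_iterate_eq_zero hX _ (fun v hv => by
      simp only [G, hN m σ hσ k _ hv, zero_mul]) _ hw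
  have hE0 : ∀ σ, NH ≤ σ → (Dx^[σ] (pd (σ, k) H)) (xJet w) = 0 := fun σ hσ =>
    totalD_iterate_eq_zero hP _ (hNH () σ hσ k) _ hw
  let R := max N NH
  have hsum : eulerXT (lagrangian L.toPot H) k w = ∑ a ∈ Finset.range (R + 1), (T a 0 + T a 1) := by
    refine (finsum_eq_sum_of_support_subset (s := Finset.range (R + 1) ×ˢ Finset.range 2) _
      ?_).trans ?_
    · rintro ⟨a, b⟩ hs
      by_contra hc
      refine hs (show T a b = 0 from ?_)
      by_cases hb : b = 0
      · subst hb
        obtain ⟨σ, rfl⟩ : ∃ σ, a = σ + 1 := ⟨a - 1, by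
          have : ¬ a < R + 1 := fun h => hc (by simpa using h)
          omega⟩
        have hσ : R ≤ σ := by
          by_contra h
          exact hc (by simpa using h)
        rw [hTs0, hE0 _ (((le_max_right _ _).trans hσ).trans (Nat.le_succ _)),
          Finset.sum_eq_zero fun m _ => hG0 σ ((le_max_left _ _).trans hσ) m]
        simp
      · refine hT0 a b hb fun h => hc ?_
        rw [h]
        simp
    · rw [Finset.sum_product]
      exact Finset.sum_congr rfl fun a _ => by simp [Finset.sum_range_succ, T]
  have hE : euler H k (xJet w) = ∑ σ ∈ Finset.range R,
      (-1 : ℝ) ^ (σ + 1) * (Dx^[σ + 1] (pd (σ + 1, k) H)) (xJet w) + pd (0, k) H (xJet w) := by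
    refine (finsum_eq_sum_range (N := R + 1) fun σ hσ => ?_).trans ?_
    · rw [hE0 σ (by omega), mul_zero]
    · rw [Finset.sum_range_succ']
      simp
  have hLag : ∑ σ ∈ Finset.range R, (-1 : ℝ) ^ σ * ∑ m, (totalD ((1, 0) : ℕ × ℕ))^[σ + 1]
      (G σ m) w = ∑ m, ∑ σ ∈ Finset.range N, (-1 : ℝ) ^ σ *
        (totalD ((1, 0) : ℕ × ℕ))^[σ + 1] (G σ m) w := by
    rw [Finset.sum_comm, ← Finset.sum_subset (Finset.range_mono (le_max_left N NH))]
    · simp only [Finset.mul_sum]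
    · intro σ _ hσ
      rw [Finset.sum_eq_zero fun m _ => hG0 σ (by simpa using hσ) m, mul_zero]
  rw [hsum, Finset.sum_range_succ']
  simp only [hTs0, hT00, hT01, hT0 _ 1 one_ne_zero (by simp : (_ + 1, 1) ≠ (0, 1)), add_zero,
    Finset.sum_sub_distrib, Finset.sum_neg_distrib, hLag]
  simp only [lagForm]
  change _ = -(_ + ∑ m, ∑ σ ∈ Finset.range N, (-1 : ℝ) ^ σ *
        (totalD ((1, 0) : ℕ × ℕ))^[σ + 1] (G σ m) w) - _
  linarith [hE]

end EulerLagrange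

/-! ### Substitution of a covector for `φ_t` -/

section Transfer

variable {n : ℕ} {Ω : Set (Jet ℕ n)} {Φ : Jet ℕ n → Jet (ℕ × ℕ) n} {η : VecFun n}

/-- On the image of a holonomic map, `φ_t = η` implies `∂_x^σ φ_t = D_x^σ η`. -/
theorem IsHolonomic.apply_t (hΩ : IsOpen Ω)
    (hΦ : IsHolonomic (potDomain Ω) (xtDomain Ω) 1 ((1, 0) : ℕ × ℕ) Φ) (hη : IsDiffVec Ω η)
    (ht : ∀ y ∈ potDomain Ω, ∀ m, Φ y ((0, 1), m) = η m (uJet y)) (σ : ℕ) (m : Fin n) :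
    ∀ y ∈ potDomain Ω, Φ y ((σ, 1), m) = (Dx^[σ] (η m)) (uJet y) := by
  induction σ with
  | zero => exact fun y hy => ht y hy m
  | succ σ ih =>
    intro y hy
    refine (hΦ.totalD_eq ((σ, 1), m) y hy).symm.trans ?_
    refine (totalD_congr (isOpen_potDomain hΩ) 1 ih hy).trans ?_
    rw [Function.iterate_succ_apply']
    exact (isHolonomic_uJet Ω).totalD_iterate_comp (isOpen_potDomain hΩ) hΩ
      ((hη m).totalD_iterate hΩ 1 σ) 1 hy

theorem lagForm_comp (hΩ : IsOpen Ω)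
    (hΦ : IsHolonomic (potDomain Ω) (xtDomain Ω) 1 ((1, 0) : ℕ × ℕ) Φ) (hη : IsDiffVec Ω η)
    (hx : ∀ y ∈ potDomain Ω, xJet (Φ y) = y)
    (ht : ∀ y ∈ potDomain Ω, ∀ m, Φ y ((0, 1), m) = η m (uJet y))
    {L : VecFun n} (hL : IsDiffVec Ω L) (N : ℕ) {y : Jet ℕ n}
    (hy : y ∈ potDomain Ω) : lagForm L N (Φ y) = lieForm L N η (uJet y) := by
  funext k
  have hP := isOpen_potDomain hΩ
  have hG : ∀ σ m, (totalD ((1, 0) : ℕ × ℕ))^[σ + 1]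
      (fun v => pd (σ, k) (L m) (uJet (xJet v)) * v ((0, 1), m)) (Φ y) =
      (Dx^[σ + 1] (fun z => pd (σ, k) (L m) z * η m z)) (uJet y) := fun σ m => by
    have hpd := (hL m).pd hΩ (σ, k)
    refine (hΦ.totalD_iterate_comp hP (isOpen_xtDomain hΩ)
      ((isDiffFun_comp_uJet_xJet hpd).mul (IsDiffFun.coord _ _)) (σ + 1) hy).symm.trans ?_
    refine Eq.trans ?_ ((isHolonomic_uJet Ω).totalD_iterate_comp hP hΩ
      (hpd.mul (hη m)) (σ + 1) hy)
    exact totalD_iterate_congr hP 1 (fun x hxm => by simp only [hx x hxm, ht x hxm]) _ hy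
  simp only [lagForm, lieForm, hx y hy, hΦ.apply_t hΩ hη ht _ _ y hy, hG]

theorem opForm_comp (hΩ : IsOpen Ω)
    (hΦ : IsHolonomic (potDomain Ω) (xtDomain Ω) 1 ((1, 0) : ℕ × ℕ) Φ) (hη : IsDiffVec Ω η)
    (hx : ∀ y ∈ potDomain Ω, xJet (Φ y) = y)
    (ht : ∀ y ∈ potDomain Ω, ∀ m, Φ y ((0, 1), m) = η m (uJet y))
    (M : Matrix (Fin n) (Fin n) ℝ) {A : DiffOp n} {N : ℕ}
    (hN : ∀ σ, N ≤ σ → ∀ i j, ∀ z ∈ Ω, A σ i j z = 0) {y : Jet ℕ n}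
    (hy : y ∈ potDomain Ω) :
    opForm A M N (Φ y) = fun i => A.app (matVec M η) i (uJet y) := by
  funext i
  have hz : uJet y ∈ Ω := hy
  refine Finset.sum_congr rfl fun q _ => ?_
  rw [finsum_eq_sum_range fun σ hσ => by rw [hN σ hσ i q _ hz, zero_mul]]
  refine Finset.sum_congr rfl fun σ _ => ?_
  rw [hx y hy, Dx_iterate_matVec hΩ hη σ q hz]
  simp only [hΦ.apply_t hΩ hη ht _ _ y hy]

/-- The graph of `φ_t = η`, as a map from `x`-jets to `(x, t)`-jets. Derivatives of higher order
in `t` are irrelevant and given the values of the first. -/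
noncomputable def graphJet (η : VecFun n) (y : Jet ℕ n) : Jet (ℕ × ℕ) n :=
  fun q => if q.1.2 = 0 then y (q.1.1, q.2) else (Dx^[q.1.1] (η q.2)) (uJet y)

theorem xJet_graphJet (η : VecFun n) (y : Jet ℕ n) : xJet (graphJet η y) = y :=
  funext fun _ => by simp [xJet, graphJet]

theorem isHolonomic_graphJet (hΩ : IsOpen Ω) (hη : IsDiffVec Ω η) :
    IsHolonomic (potDomain Ω) (xtDomain Ω) 1 ((1, 0) : ℕ × ℕ) (graphJet η) where
  mapsTo y hy := by
    change xJet _ ∈ potDomain Ω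
    rwa [xJet_graphJet]
  isDiffFun := by
    rintro ⟨⟨a, b⟩, m⟩
    by_cases hb : b = 0
    · simpa [graphJet, hb] using IsDiffFun.coord _ _
    · simp only [graphJet, hb, if_false]
      exact ((hη m).totalD_iterate hΩ 1 a).comp
        (isHolonomic_uJet Ω).isDiffFun (isHolonomic_uJet Ω).mapsTo
  totalD_eq := by
    rintro ⟨⟨a, b⟩, m⟩ y hy
    by_cases hb : b = 0
    · simpa [graphJet, hb] using totalD_coord y 1 (a, m)
    · simp only [graphJet, hb, if_false, Prod.mk_add_mk, add_zero, Function.iterate_succ_apply']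
      exact (isHolonomic_uJet Ω).totalD_iterate_comp (isOpen_potDomain hΩ) hΩ
        ((hη m).totalD_iterate hΩ 1 a) 1 hy

/-- The map of `x`-jets to `(x, t)`-jets with `φ_{σ,τ} = φ_{sτ+σ}`, that is, `∂_t = ∂_x^s`. -/
def relabelJet (s : ℕ) (y : Jet ℕ n) : Jet (ℕ × ℕ) n := fun q => y (s * q.1.2 + q.1.1, q.2)

theorem xJet_relabelJet (s : ℕ) (y : Jet ℕ n) : xJet (relabelJet s y) = y := by
  funext q
  simp [xJet, relabelJet]

theorem isHolonomic_relabelJet (Ω : Set (Jet ℕ n)) (s : ℕ) :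
    IsHolonomic (potDomain Ω) (xtDomain Ω) 1 ((1, 0) : ℕ × ℕ) (relabelJet s) where
  mapsTo y hy := by
    change xJet _ ∈ potDomain Ω
    rwa [xJet_relabelJet]
  isDiffFun _ := IsDiffFun.coord _ _
  totalD_eq q y _ := totalD_coord y 1 (s * q.1.2 + q.1.1, q.2)

/-- A differential function of `(x, t)`-jets vanishes as soon as it vanishes on the images of
the maps `relabelJet s`: any `(x, t)`-jet agrees with such an image up to order `s` in `x`. -/
theorem eq_zero_of_relabelJet (hΩ : IsOpen Ω) {F : Jet (ℕ × ℕ) n → ℝ}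
    (hF : IsDiffFun (xtDomain Ω) F)
    (h : ∀ s, 0 < s → ∀ y ∈ potDomain Ω, F (relabelJet s y) = 0)
    {w : Jet (ℕ × ℕ) n} (hw : w ∈ xtDomain Ω) : F w = 0 := by
  obtain ⟨P, hP⟩ := hF.exists_finset_congr (isOpen_xtDomain hΩ) hw
  -- Division with remainder by `s` recovers `(σ, τ)` from `s τ + σ` as long as `σ < s`.
  let s := P.sup (fun p => p.1.1) + 1
  let y : Jet ℕ n := fun p => w ((p.1 % s, p.1 / s), p.2)
  obtain ⟨hmem, heq⟩ := hP (relabelJet s y) fun p hp => by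
    have hlt : p.1.1 < s := Nat.lt_succ_of_le (Finset.le_sup (f := fun p => p.1.1) hp)
    have h1 : (s * p.1.2 + p.1.1) % s = p.1.1 := by
      rw [Nat.mul_add_mod, Nat.mod_eq_of_lt hlt]
    have h2 : (s * p.1.2 + p.1.1) / s = p.1.2 := by
      rw [Nat.mul_add_div (Nat.succ_pos _), Nat.div_eq_of_lt hlt, add_zero]
    simp only [relabelJet, y, h1, h2]
  rw [← heq]
  refine h s (Nat.succ_pos _) y ?_
  change xJet _ ∈ potDomain Ω at hmem
  rwa [xJet_relabelJet] at hmem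

end Transfer

/-! ### Comparison of the two identities -/

section Comparison

variable {n : ℕ} {Ω : Set (Jet ℕ n)} {K : Matrix (Fin n) (Fin n) ℝ}

theorem symplecticSystem_eq {A : DiffOp n} {N : ℕ}
    (hN : ∀ σ, N ≤ σ → ∀ i j, ∀ z ∈ Ω, A σ i j z = 0) (H : Jet ℕ n → ℝ) (i : Fin n)
    {w : Jet (ℕ × ℕ) n} (hw : w ∈ xtDomain Ω) :
    symplecticSystem K A H i w =
      -(K⁻¹.mulVec (opForm A K⁻¹ N w)) i - euler H i (xJet w) := by
  have hz : uJet (xJet w) ∈ Ω := hw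
  unfold symplecticSystem
  congr 1
  have h : ∀ m, ∑ᶠ σ : ℕ, symplecticOp K A σ i m (xJet w) * w ((σ, 1), m) =
      ∑ σ ∈ Finset.range N, symplecticOp K A σ i m (xJet w) * w ((σ, 1), m) := fun m =>
    finsum_eq_sum_range fun σ hσ => by
      simp [symplecticOp, DiffOp.toPot, hN σ hσ _ _ _ hz]
  simp only [h]
  simp only [symplecticOp, DiffOp.toPot, Matrix.mulVec, dotProduct, opForm, neg_mul,
    Finset.sum_neg_distrib, Finset.sum_mul, Finset.mul_sum]
  simp only [Finset.sum_comm (s := Finset.univ (α := Fin n)) (t := Finset.range N)]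
  rw [neg_inj]
  refine Finset.sum_congr rfl fun σ _ => ?_
  rw [Finset.sum_comm]
  refine Finset.sum_congr rfl fun p _ => ?_
  rw [Finset.sum_comm]
  exact Finset.sum_congr rfl fun q _ => Finset.sum_congr rfl fun m _ => by ring

theorem mulVec_eq_iff_eq_mulVec_inv (hK : IsUnit K.det) (a b : Fin n → ℝ) :
    a = K⁻¹.mulVec b ↔ K.mulVec a = b := by
  constructor
  · rintro rfl
    rw [Matrix.mulVec_mulVec, Matrix.mul_nonsing_inv _ hK, Matrix.one_mulVec]
  · rintro rfl
    rw [Matrix.mulVec_mulVec, Matrix.nonsing_inv_mul _ hK, Matrix.one_mulVec]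

theorem isLagrangianRep_iff (hΩ : IsOpen Ω) (hK : IsUnit K.det) {A : DiffOp n}
    {h : ℕ → Jet ℕ n → ℝ} (hh : ∀ k, IsDiffFun (potDomain Ω) (h k)) {L : VecFun n}
    (hL : IsDiffVec Ω L) {N : ℕ}
    (hNA : ∀ σ, N ≤ σ → ∀ i j, ∀ z ∈ Ω, A σ i j z = 0)
    (hNL : ∀ m, ∀ σ, N ≤ σ → ∀ i, ∀ z ∈ Ω, pd (σ, i) (L m) z = 0) :
    IsLagrangianRep Ω K A h L.toPot ↔
      ∀ w ∈ xtDomain Ω, K.mulVec (lagForm L N w) = opForm A K⁻¹ N w := by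
  have key : ∀ k i, ∀ w ∈ xtDomain Ω,
      (eulerXT (lagrangian L.toPot (h (k + 2))) i w = symplecticSystem K A (h (k + 2)) i w ↔
        lagForm L N w i = (K⁻¹.mulVec (opForm A K⁻¹ N w)) i) := fun k i w hw => by
    rw [eulerXT_lagrangian hΩ hL hNL (hh _) i hw, symplecticSystem_eq hNA _ i hw,
      sub_left_inj, neg_inj]
  simp only [← mulVec_eq_iff_eq_mulVec_inv hK]
  -- The condition is the same for every `k`, as the variational derivative of `h (k + 2)` cancels.
  constructor
  · exact fun hrep w hw => funext fun i => (key 0 i w hw).1 (hrep.2 0 i w hw)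
  · exact fun heq => ⟨hL.toPot, fun k i w hw => (key k i w hw).2 (congrFun (heq w hw) i)⟩

theorem isLieDerivOf_iff (hΩ : IsOpen Ω) (hKsymm : K.IsSymm) (hK : IsUnit K.det) {A : DiffOp n}
    {L : VecFun n} (hL : IsDiffVec Ω L) {N : ℕ}
    (hNL : ∀ m, ∀ σ, N ≤ σ → ∀ i, ∀ z ∈ Ω, pd (σ, i) (L m) z = 0) :
    IsLieDerivOf Ω A (tauOf K L) (constOp K) ↔
      ∀ η, IsDiffVec Ω η → ∀ z ∈ Ω,
        K.mulVec (lieForm L N η z) = fun i => A.app (matVec K⁻¹ η) i z := by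
  constructor
  · intro hLie η hη z hz
    funext i
    refine Eq.trans ?_ (hLie _ (isDiffVec_matVec K⁻¹ hη) i z hz).symm
    rw [lieDeriv_tauOf_constOp hΩ hKsymm hL hNL (isDiffVec_matVec K⁻¹ hη) i hz, matVec_matVec,
      Matrix.mul_nonsing_inv _ hK, matVec_one]
    rfl
  · intro h ξ hξ i z hz
    have := congrFun (h _ (isDiffVec_matVec K hξ) z hz) i
    rw [matVec_matVec, Matrix.nonsing_inv_mul _ hK, matVec_one] at this
    rw [lieDeriv_tauOf_constOp hΩ hKsymm hL hNL hξ i hz]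
    exact this.symm

/-- Substituting `φ_t = η` in the identity on `(x, t)`-jets gives the operator identity on
covectors. Conversely the covectors `η = u_{s-1}` with `s` large give arbitrary values to any
finite number of the jet coordinates of `φ_t`. -/
theorem isLagrangianRep_iff_isLieDerivOf (hΩ : IsOpen Ω) (hKsymm : K.IsSymm)
    (hK : IsUnit K.det) {A : DiffOp n} (hA : IsDiffOp Ω A) {h : ℕ → Jet ℕ n → ℝ}
    (hh : ∀ k, IsDiffFun (potDomain Ω) (h k)) {L : VecFun n} (hL : IsDiffVec Ω L) :
    IsLagrangianRep Ω K A h L.toPot ↔ IsLieDerivOf Ω A (tauOf K L) (constOp K) := by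
  obtain ⟨r, hr⟩ := hA.2
  obtain ⟨N₀, hN₀⟩ := exists_order_bound hΩ hL
  let N := max (r + 1) N₀
  have hNA : ∀ σ, N ≤ σ → ∀ i j, ∀ z ∈ Ω, A σ i j z = 0 := fun σ hσ =>
    hr σ (lt_of_lt_of_le (Nat.lt_succ_self r) ((le_max_left _ _).trans hσ))
  have hNL : ∀ m, ∀ σ, N ≤ σ → ∀ i, ∀ z ∈ Ω, pd (σ, i) (L m) z = 0 := fun m σ hσ =>
    hN₀ m σ ((le_max_right _ _).trans hσ)
  rw [isLagrangianRep_iff hΩ hK hh hL hNA hNL, isLieDerivOf_iff hΩ hKsymm hK hL hNL]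
  constructor
  · intro hLag η hη z hz
    -- Any potential for `z` will do; the value of `φ` itself is irrelevant.
    let y : Jet ℕ n := fun p => z (p.1 - 1, p.2)
    have hy : y ∈ potDomain Ω := hz
    have hΦ := isHolonomic_graphJet hΩ hη
    have hx : ∀ y ∈ potDomain Ω, xJet (graphJet η y) = y := fun y _ => xJet_graphJet η y
    have ht : ∀ y ∈ potDomain Ω, ∀ m, graphJet η y ((0, 1), m) = η m (uJet y) :=
      fun y _ m => if_neg one_ne_zero
    have heq := hLag _ (hΦ.mapsTo hy)
    rwa [lagForm_comp hΩ hΦ hη hx ht hL N hy, opForm_comp hΩ hΦ hη hx ht K⁻¹ hNA hy] at heq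
  · intro hLie w hw
    funext i
    have hdiff : IsDiffFun (xtDomain Ω) (fun w => K.mulVec (lagForm L N w) i) :=
      (IsDiffFun.sum Finset.univ fun k _ => (isDiffFun_lagForm hΩ hL N k).const_mul (K i k)).congr
        fun _ _ => rfl
    refine sub_eq_zero.1 (eq_zero_of_relabelJet hΩ
      (F := fun w => K.mulVec (lagForm L N w) i - opForm A K⁻¹ N w i)
      (hdiff.sub (isDiffFun_opForm hA K⁻¹ N i)) ?_ hw)
    intro s hs y hy
    -- `u_{s-1} = φ_s`, which is `φ_t` on the image of `relabelJet s`.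
    let η : VecFun n := fun m z => z (s - 1, m)
    have hη : IsDiffVec Ω η := fun m => IsDiffFun.coord _ _
    have hΦ := isHolonomic_relabelJet Ω s
    have hx : ∀ y ∈ potDomain Ω, xJet (relabelJet s y) = y := fun y _ => xJet_relabelJet s y
    have ht : ∀ y ∈ potDomain Ω, ∀ m, relabelJet s y ((0, 1), m) = η m (uJet y) := fun y _ m => by
      simp [relabelJet, η, uJet, Nat.sub_add_cancel hs]
    have heq := hLie η hη (uJet y) hy
    rw [← lagForm_comp hΩ hΦ hη hx ht hL N hy, ← opForm_comp hΩ hΦ hη hx ht K⁻¹ hNA hy] at heq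
    exact sub_eq_zero.2 (congrFun heq i)

end Comparison

end VarCalc

theorem mainTheorem2 {n : ℕ} (Ω : Set (Jet ℕ n)) (hΩ : IsOpen Ω)
    (K : Matrix (Fin n) (Fin n) ℝ) (hKsymm : K.IsSymm) (hKdet : IsUnit K.det)
    (A₂ : DiffOp n) (hA₂ : IsHamiltonian Ω A₂) (hcomp : Compatible Ω (constOp K) A₂)
    (h : ℕ → Jet ℕ n → ℝ) (hh : IsHierarchy Ω K A₂ h) :
    (∀ L : VecFun n, IsDiffVec Ω L →
      (IsLagrangianRep Ω K A₂ h L.toPot ↔ IsLieDerivOf Ω A₂ (tauOf K L) (constOp K))) ∧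
    Set.BijOn (tauOf K)
      {L | IsDiffVec Ω L ∧ IsLagrangianRep Ω K A₂ h L.toPot}
      {τ | IsDiffVec Ω τ ∧ IsLieDerivOf Ω A₂ τ (constOp K)} ∧
    ((∃ L : VecFun n, IsDiffVec Ω L ∧ IsLagrangianRep Ω K A₂ h L.toPot) ↔
      ∃ τ : VecFun n, IsDiffVec Ω τ ∧ IsLieDerivOf Ω A₂ τ (constOp K)) := by
  have hiff : ∀ L : VecFun n, IsDiffVec Ω L →
      (IsLagrangianRep Ω K A₂ h L.toPot ↔ IsLieDerivOf Ω A₂ (tauOf K L) (constOp K)) :=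
    fun L hL => isLagrangianRep_iff_isLieDerivOf hΩ hKsymm hKdet hA₂.1 hh.1 hL
  have hleft : ∀ L : VecFun n, matVec (-K⁻¹) (tauOf K L) = L := fun L => by
    rw [tauOf_eq_matVec, matVec_matVec, neg_mul_neg, Matrix.nonsing_inv_mul _ hKdet, matVec_one]
  have hright : ∀ τ : VecFun n, tauOf K (matVec (-K⁻¹) τ) = τ := fun τ => by
    rw [tauOf_eq_matVec, matVec_matVec, neg_mul_neg, Matrix.mul_nonsing_inv _ hKdet, matVec_one]
  have hbij : Set.BijOn (tauOf K)
      {L | IsDiffVec Ω L ∧ IsLagrangianRep Ω K A₂ h L.toPot}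
      {τ | IsDiffVec Ω τ ∧ IsLieDerivOf Ω A₂ τ (constOp K)} := by
    refine ⟨fun L hL => ⟨?_, (hiff L hL.1).1 hL.2⟩, fun L _ L' _ hLL' => ?_, fun τ hτ => ?_⟩
    · rw [tauOf_eq_matVec]
      exact isDiffVec_matVec _ hL.1
    · rw [← hleft L, hLL', hleft L']
    · have hd := isDiffVec_matVec (-K⁻¹) hτ.1
      refine ⟨matVec (-K⁻¹) τ, ⟨hd, (hiff _ hd).2 ?_⟩, hright τ⟩
      rw [hright]
      exact hτ.2
  refine ⟨hiff, hbij, ⟨?_, ?_⟩⟩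
  · rintro ⟨L, hL⟩
    exact ⟨tauOf K L, hbij.mapsTo hL⟩
  · rintro ⟨τ, hτ⟩
    obtain ⟨L, hL, -⟩ := hbij.surjOn hτ
    exact ⟨L, hL⟩
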